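/- Setting. Let $D$ be a finite-dimensional real Lie group with Lie algebra $\mathcal D$ carrying a symmetric, non-degenerate, $\mathrm{Ad}_D$-invariant bilinear form $\langle\cdot|\cdot\rangle$, and let $G,\hat G\subset D$ be (immersed) Lie subgroups whose Lie algebras $\mathcal G,\hat{\mathcal G}$ are isotropic and satisfy $\mathcal D=\mathcal G\oplus\hat{\mathcal G}$. Assume that $D$ is a perfect Drinfeld double: every $l\in D$ is uniquely $l=g\hat h$ with $g\in G$, $\hat h\in\hat G$ (hence also uniquely $l=\hat g h$). Let $J,\hat J$ be the projections of $\mathcal D$ onto $\mathcal G$ along $\hat{\mathcal G}$ and onto $\hat{\mathcal G}$ along $\mathcal G$, and put $\Pi^g=J\,\mathrm{Ad}_g\,J\,\mathrm{Ad}_{g^{-1}}\hat J:\hat{\mathcal G}\to\mathcal G$ for $g\in G$, and $\hat\Pi^{\hat g}=\hat J\,\mathrm{Ad}_{\hat g}\,\hat J\,\mathrm{Ad}_{\hat g^{-1}}J:\mathcal G\to\hat{\mathcal G}$ for $\hat g\in\hat G$. Let $F$ be an (immersed) Lie subgroup of $D$. It acts on $G$ by the dressing action: $f\rhd g$ is the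 factor in $G$ of $fg=(f\rhd g)\hat h$; and on $\hat G$ by: $f\rhd\hat g$ is the factor in $\hat G$ of $f\hat g=(f\rhd\hat g)h$. Fields are smooth maps on the world-sheet $\mathbb R^2$ with coordinates $(\tau,\sigma)$, and $\partial_\pm=\partial_\tau\pm\partial_\sigma$. A gauge transformation supported in a compact set $K\subset\mathbb R^2$ is a smooth $f:\mathbb R^2\to F$ with $f=1$ off $K$ that is connected to the constant map $1$ by a smooth homotopy through maps equal to $1$ off $K$ (for example $f=e^{\epsilon}$, with $\epsilon$ smooth, Lie$(F)$-valued and zero off $K$). Gauge invariance. Consider a $\sigma$-model on $G$ with action $S_K(g)=\frac12\int_K\ell_g(\partial_-gg^{-1},\partial_+gg^{-1})\,d\tau d\sigma$, where $\ell_g$ is a bilinear form on $\mathcal G$ defined for $g$ in a subset $G^{\rm adm}\subset G$. We call it gauge invariant under the dressing action of $F$ if: (a) for $f\in F$, $f\rhd g\in G^{\rm adm}$ if and only if $g\in G^{\rm adm}$; (b) for all smooth $f:\mathbb R^2\to F$ and $g:\mathbb R^2\to G$, the field $f\rhd g$ is smooth and defines the same field with values in the orbit space $F\backslash G$ as $g$;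 (c) for every compact $K$, every gauge transformation $f$ supported in $K$ and every field $g$ with $g(K)\subset G^{\rm adm}$, the Lagrangians of $g$ and of $f\rhd g$ are integrable on $K$ and $S_K(f\rhd g)=S_K(g)$; (d) the target metric $v\mapsto\ell_g(v,v)$ satisfies $\ell_{f\rhd g}(v',v')=\ell_g(v,v)$, at each point at which $g\in G^{\rm adm}$, for all smooth $f,g$ and every derivative $\partial_u$ on the world-sheet, where $v=\partial_ug\,g^{-1}$ and $v'=\partial_u(f\rhd g)(f\rhd g)^{-1}$. In this sense the target space is $F\backslash G$. The same definition, with the roles of $G$ and $\hat G$ exchanged, is used on $\hat G$ and $F\backslash\hat G$. All adjoints below are with respect to $\langle\cdot|\cdot\rangle$. (1) Standard dressing cosets. Let $R:\hat{\mathcal G}\to\mathcal G$ be linear and invertible with adjoint $R^*:\hat{\mathcal G}\to\mathcal G$; suppose that the Lie algebra of $F$ is $\mathcal F=\{\gamma+R\gamma:\gamma\in\mathrm{Ker}(R+R^*)\}$ and that $$J\mathrm{Ad}_f\hat J+J[\mathrm{Ad}_f,R]\hat J=R\,\mathrm{Ad}_fR\quad\text{on }\hat{\mathcal G},\text{ for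 all }f\in F,$$ that is, $J\mathrm{Ad}_fx+J\mathrm{Ad}_fRx-R\hat J\mathrm{Ad}_fx=R\hat J\mathrm{Ad}_fRx$. Then the model $S(g)=\frac12\int\langle\partial_-gg^{-1}|(R+\Pi^g)^{-1}\partial_+gg^{-1}\rangle$ on $G$ and the dual model $S(\hat g)=\frac12\int\langle\partial_-\hat g\hat g^{-1}|(R^{-1}+\hat\Pi^{\hat g})^{-1}\partial_+\hat g\hat g^{-1}\rangle$ on $\hat G$, defined where $R+\Pi^g$, respectively $R^{-1}+\hat\Pi^{\hat g}$, is invertible, are gauge invariant under $F$. (2) Generalized dressing cosets. Let $R:\mathrm{Dom}R\to\mathcal G$ and $\hat R:\mathrm{Dom}\hat R\to\hat{\mathcal G}$ be linear, with $\mathrm{Dom}R\subset\hat{\mathcal G}$ and $\mathrm{Dom}\hat R\subset\mathcal G$ linear subspaces, and with adjoints $R^*:\mathrm{Dom}R\to\mathrm{Im}R$ and $\hat R^*:\mathrm{Dom}\hat R\to\mathrm{Im}\hat R$, such that: $\mathrm{Ker}R=\mathrm{Ker}R^*$ and $\mathrm{Ker}\hat R=\mathrm{Ker}\hat R^*$;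 $\mathrm{Im}\hat R\subset\mathrm{Dom}R$, $\mathrm{Im}R\subset\mathrm{Dom}\hat R$ and $(R|_{\mathrm{Im}\hat R})^{-1}=\hat R|_{\mathrm{Im}R}$; $\mathrm{Dom}R$ is the annihilator of $\mathrm{Ker}\hat R$ in $\hat{\mathcal G}$ and $\mathrm{Dom}\hat R$ that of $\mathrm{Ker}R$ in $\mathcal G$; and the form is non-degenerate on $\mathrm{Im}R\oplus\mathrm{Im}\hat R$. Suppose that the Lie algebra of $F$ is $\mathrm{Ker}\hat R\oplus\{\gamma+R\gamma:\gamma\in\mathrm{Ker}(R+R^*)\}$ and that, for all $f\in F$, the condition of (1) holds for $R$ on $\mathrm{Dom}R$, and the condition $\hat J\mathrm{Ad}_fJ+\hat J[\mathrm{Ad}_f,\hat R]J=\hat R\,\mathrm{Ad}_f\hat R$ holds on $\mathrm{Dom}\hat R$; explicitly, for $x\in\mathrm{Dom}R$, $\hat J\mathrm{Ad}_f(x+Rx)\in\mathrm{Dom}R$ and $J\mathrm{Ad}_f(x+Rx)=R\hat J\mathrm{Ad}_f(x+Rx)$, and similarly for $\hat R$ with $J,\hat J$ exchanged. Let $\rho$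 be a projector of $\mathcal G$ onto $\mathrm{Im}R\oplus\hat{\mathcal A}$ with kernel $\mathrm{Ker}\hat R$, where $\hat{\mathcal A}$ is a complement of $\mathrm{Dom}\hat R$ in $\mathcal G$, and let $\tilde\rho$ be a projector of $\hat{\mathcal G}$ onto $\mathrm{Im}\hat R\oplus\mathcal A$ with kernel $\mathrm{Ker}R$, where $\mathcal A$ is a complement of $\mathrm{Dom}R$ in $\hat{\mathcal G}$. Then the model $S(g)=\frac12\int\langle\rho(\partial_-gg^{-1})|(R+\rho\circ\Pi^g)^{-1}\rho(\partial_+gg^{-1})\rangle$ on $G$ and the dual model $S(\hat g)=\frac12\int\langle\tilde\rho(\partial_-\hat g\hat g^{-1})|(\hat R+\tilde\rho\circ\hat\Pi^{\hat g})^{-1}\tilde\rho(\partial_+\hat g\hat g^{-1})\rangle$ on $\hat G$, defined where $R+\rho\circ\Pi^g:\mathrm{Dom}R\to\mathrm{Im}\rho$, respectively $\hat R+\tilde\rho\circ\hat\Pi^{\hat g}:\mathrm{Dom}\hat R\to\mathrm{Im}\tilde\rho$, is invertible, are gauge invariant under $F$. (3) Sfetsos' models. In (2) suppose moreover that $\mathrm{Ker}R=\mathrm{Ker}(R+R^*)=\{0\}$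 and $\mathrm{Ker}\hat R=\mathrm{Ker}(\hat R+\hat R^*)$ (so that the Lie algebra of $F$ is $\mathrm{Ker}\hat R$), and let $t_i$, $T^i$ be bases of $\mathcal G$, $\hat{\mathcal G}$ with $\langle t_i|T^j\rangle=\delta_i^j$, whose indices split into $i=\alpha$ and $i=M$ in such a way that $\mathrm{Ker}\hat R=\mathrm{Span}(t_\alpha)$, $\mathrm{Im}R=\mathrm{Span}(t_M)$, $\mathrm{Im}\hat R=\mathrm{Span}(T^M)$. Write $RT^M=R^{MN}t_N$, $\Pi^gT^i=\Pi(g)^{ij}t_j$, $\hat\Pi^{\hat g}t_i=\hat\Pi(\hat g)_{ij}T^j$. Then Sfetsos' action $$S(g)=\tfrac12\int(\partial_+gg^{-1})^M\big[(R^{PQ}+\Pi(g)^{PQ})^{-1}\big]_{MN}(\partial_-gg^{-1})^N$$ on $G$ and Sfetsos' dual action $$S(\hat g)=\tfrac12\int(\partial_+\hat g\hat g^{-1})_i\left[\begin{pmatrix}\hat\Pi_{\alpha\beta}&\hat\Pi_{\alpha N}\\ \hat\Pi_{M\beta}&(R^{-1})_{MN}+\hat\Pi_{MN}\end{pmatrix}^{-1}\right]^{ij}(\partial_-\hat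 g\hat g^{-1})_j$$ on $\hat G$, defined where these matrices are invertible, are gauge invariant under the dressing action of $F$; the second assertion is Sfetsos' conjecture. -/

import Mathlib

open scoped Manifold ContDiff
open MeasureTheory

noncomputable section

namespace DressingCosets

/-! ### Lie groups: adjoint action, logarithmic derivatives, immersed Lie subgroups -/

section LieGroups

variable (E : Type*) [NormedAddCommGroup E] [NormedSpace ℝ E]
  {D : Type*} [TopologicalSpace D] [ChartedSpace E D] [Group D]

/-- The Lie algebra of a Lie group modelled on `E`, that is, the tangent space at `1`. -/
abbrev Lie (D : Type*) [TopologicalSpace D] [ChartedSpace E D] [Group D] : Type _ :=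
  GroupLieAlgebra 𝓘(ℝ, E) D

/-- The adjoint action `Ad_d`: the derivative at `1` of the conjugation `x ↦ d x d⁻¹`
(whose value at `1` is `1`). -/
def Ad (d : D) : Lie E D →ₗ[ℝ] Lie E D :=
  (mfderiv 𝓘(ℝ, E) 𝓘(ℝ, E) (fun x : D => d * x * d⁻¹) 1).toLinearMap

/-- The world-sheet, with coordinates `(τ, σ)`. -/
abbrev Worldsheet : Type := ℝ × ℝ

/-- The direction of `∂₊ = ∂_τ + ∂_σ`. -/
def dirPlus : Worldsheet := (1, 1)

/-- The direction of `∂₋ = ∂_τ - ∂_σ`. -/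
def dirMinus : Worldsheet := (1, -1)

/-- The right logarithmic derivative `∂_u φ φ⁻¹` at `z` of a field `φ` with values in a Lie group:
the derivative at `z`, in the direction `u`, of `w ↦ φ(w) φ(z)⁻¹`, which takes the value `1`
at `z`. -/
def logDeriv (φ : Worldsheet → D) (z u : Worldsheet) : Lie E D :=
  mfderiv 𝓘(ℝ, Worldsheet) 𝓘(ℝ, E) (fun w => φ w * (φ z)⁻¹) z u

/-- Smooth fields on the world-sheet. -/
def IsField (φ : Worldsheet → D) : Prop :=
  ContMDiff 𝓘(ℝ, Worldsheet) 𝓘(ℝ, E) ∞ φ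

/-- A gauge transformation supported in `K`: a smooth field `f` which is `1` off `K` and which is
connected to the constant field `1` by a smooth homotopy `h` that is `1` off `K`.
In particular `f = exp ε`, for `ε` smooth and zero off `K`, is one, with `h t = exp (t ε)`. -/
def IsGaugeTransformation (K : Set Worldsheet) (f : Worldsheet → D) : Prop :=
  ∃ h : ℝ × Worldsheet → D, ContMDiff 𝓘(ℝ, ℝ × Worldsheet) 𝓘(ℝ, E) ∞ h ∧
    (∀ z, h (0, z) = 1) ∧ (∀ z, h (1, z) = f z) ∧ ∀ t, ∀ z ∉ K, h (t, z) = 1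

variable {E}
variable {E' : Type*} [NormedAddCommGroup E'] [NormedSpace ℝ E']
  {S : Type*} [TopologicalSpace S] [ChartedSpace E' S] [Group S]

variable (E E') in
/-- The homomorphism of Lie algebras given by the derivative at `1` of a homomorphism `i` of Lie
groups (recall `i 1 = 1`). -/
def dHom (i : S →* D) : Lie E' S →ₗ[ℝ] Lie E D :=
  (mfderiv 𝓘(ℝ, E') 𝓘(ℝ, E) i 1).toLinearMap

variable (E E') in
/-- `i` exhibits the Lie group `S` as a (not necessarily closed) Lie subgroup of `D`. -/
structure IsLieSubgroup (i : S →* D) : Prop where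
  smooth : ContMDiff 𝓘(ℝ, E') 𝓘(ℝ, E) ∞ i
  injective : Function.Injective i
  immersive : Function.Injective (dHom E E' i)

variable (E E') in
/-- The Lie algebra of a Lie subgroup, as a subspace of the Lie algebra of the ambient group. -/
def lieAlgebraOf (i : S →* D) : Submodule ℝ (Lie E D) := LinearMap.range (dHom E E' i)

end LieGroups


/-! ### Partially defined linear operators -/

section Partial

variable {V W : Type*} [AddCommGroup V] [Module ℝ V] [AddCommGroup W] [Module ℝ W]

/-- `Ker R`, as a subspace of the ambient space of the domain. -/
def kerP (R : V →ₗ.[ℝ] W) : Submodule ℝ V := (LinearMap.ker R.toFun).map R.domain.subtype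

/-- `Im R`. -/
def imP (R : V →ₗ.[ℝ] W) : Submodule ℝ W := LinearMap.range R.toFun

theorem mem_imP (R : V →ₗ.[ℝ] W) (x : R.domain) : R x ∈ imP R := ⟨x, rfl⟩

end Partial

/-! ### Perfect Drinfeld doubles -/

section Double

variable {E EG EH : Type*}
  [NormedAddCommGroup E] [NormedSpace ℝ E] [NormedAddCommGroup EG] [NormedSpace ℝ EG]
  [NormedAddCommGroup EH] [NormedSpace ℝ EH]
  {D G H : Type*}
  [TopologicalSpace D] [ChartedSpace E D] [Group D]
  [TopologicalSpace G] [ChartedSpace EG G] [Group G]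
  [TopologicalSpace H] [ChartedSpace EH H] [Group H]

variable (E EG EH D G H) in
/-- A perfect Drinfeld double `D` with its subgroups `G` and `H = Ĝ`: the Lie algebra of `D`
carries a symmetric non-degenerate invariant form, the Lie algebras of `G` and `Ĝ` are isotropic
and complementary, and every `l ∈ D` is uniquely `l = g ĥ`. -/
structure PerfectDouble where
  inG : G →* D
  inH : H →* D
  isLieSubgroup_inG : IsLieSubgroup E EG inG
  isLieSubgroup_inH : IsLieSubgroup E EH inH
  form : LinearMap.BilinForm ℝ (Lie E D)
  form_symm : ∀ x y, form x y = form y x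
  form_nondegenerate : form.Nondegenerate
  form_invariant : ∀ (d : D) (x y : Lie E D), form (Ad E d x) (Ad E d y) = form x y
  isCompl : IsCompl (lieAlgebraOf E EG inG) (lieAlgebraOf E EH inH)
  isotropicG : ∀ x ∈ lieAlgebraOf E EG inG, ∀ y ∈ lieAlgebraOf E EG inG, form x y = 0
  isotropicH : ∀ x ∈ lieAlgebraOf E EH inH, ∀ y ∈ lieAlgebraOf E EH inH, form x y = 0
  perfect : ∀ l : D, ∃! p : G × H, l = inG p.1 * inH p.2

namespace PerfectDouble

/-- The same double with the roles of `G` and `Ĝ` exchanged; now `l = ĝ h`. -/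
@[reducible] def swap (P : PerfectDouble E EG EH D G H) : PerfectDouble E EH EG D H G where
  inG := P.inH
  inH := P.inG
  isLieSubgroup_inG := P.isLieSubgroup_inH
  isLieSubgroup_inH := P.isLieSubgroup_inG
  form := P.form
  form_symm := P.form_symm
  form_nondegenerate := P.form_nondegenerate
  form_invariant := P.form_invariant
  isCompl := P.isCompl.symm
  isotropicG := P.isotropicH
  isotropicH := P.isotropicG
  perfect := by
    intro l
    obtain ⟨⟨g, h⟩, hl, huniq⟩ := P.perfect l⁻¹
    refine ⟨(h⁻¹, g⁻¹), ?_, ?_⟩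
    · simp only [map_inv, ← mul_inv_rev]
      exact (inv_eq_iff_eq_inv.mpr (by rw [← hl])).symm
    · rintro ⟨h', g'⟩ hl'
      have key := huniq (g'⁻¹, h'⁻¹) (by simp [hl'])
      simp only [Prod.mk.injEq] at key ⊢
      exact ⟨by rw [← key.2, inv_inv], by rw [← key.1, inv_inv]⟩

variable (P : PerfectDouble E EG EH D G H)

/-- The Lie algebra of `G`, inside that of `D`. -/
abbrev alg : Submodule ℝ (Lie E D) := lieAlgebraOf E EG P.inG

/-- The Lie algebra of `Ĝ`, inside that of `D`. -/
abbrev dualAlg : Submodule ℝ (Lie E D) := lieAlgebraOf E EH P.inH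

/-- The projection `J` onto the Lie algebra of `G` along that of `Ĝ`. -/
def J : Lie E D →ₗ[ℝ] P.alg := Submodule.projectionOnto P.alg P.dualAlg P.isCompl

/-- The projection `Ĵ` onto the Lie algebra of `Ĝ` along that of `G`. -/
def Jhat : Lie E D →ₗ[ℝ] P.dualAlg := Submodule.projectionOnto P.dualAlg P.alg P.isCompl.symm

/-- `Π^g = J Ad_g J Ad_{g⁻¹} Ĵ`, from the Lie algebra of `Ĝ` to that of `G`. -/
def poisson (g : G) : P.dualAlg →ₗ[ℝ] P.alg :=
  P.J ∘ₗ Ad E (P.inG g) ∘ₗ P.alg.subtype ∘ₗ P.J ∘ₗ Ad E (P.inG g)⁻¹ ∘ₗ P.dualAlg.subtype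

/-- The factor `g ∈ G` of `l = g ĥ`. -/
def factor (l : D) : G := (P.perfect l).choose.1

/-- The dressing action of `D` on `G`: `d ▷ g` is the factor in `G` of `d g`. -/
def dress (d : D) (g : G) : G := P.factor (d * P.inG g)

theorem factor_eq {l : D} {g : G} {h : H} (e : l = P.inG g * P.inH h) : P.factor l = g := by
  have := (P.perfect l).choose_spec.2 (g, h) e
  exact (congrArg Prod.fst this).symm

theorem factor_spec (l : D) : ∃ h : H, l = P.inG (P.factor l) * P.inH h :=
  ⟨(P.perfect l).choose.2, (P.perfect l).choose_spec.1⟩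

/-- The dressing action on `G` of a group `F` mapped to `D`. -/
@[reducible] def dressingAction {F : Type*} [Group F] (i : F →* D) : MulAction F G where
  smul f g := P.dress (i f) g
  one_smul g := P.factor_eq (h := 1) (by simp)
  mul_smul f₁ f₂ g := by
    obtain ⟨h₂, e₂⟩ := P.factor_spec (i f₂ * P.inG g)
    obtain ⟨h₁, e₁⟩ := P.factor_spec (i f₁ * P.inG (P.factor (i f₂ * P.inG g)))
    refine P.factor_eq (h := h₁ * h₂) ?_
    change _ = P.inG (P.factor (i f₁ * P.inG (P.factor (i f₂ * P.inG g)))) * _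
    rw [map_mul, map_mul, ← mul_assoc, ← e₁, mul_assoc, mul_assoc, ← e₂]

/-- The target space `F \ G`: the space of orbits of the dressing action of `F` on `G`. -/
def Target {F : Type*} [Group F] (i : F →* D) : Type _ :=
  @MulAction.orbitRel.Quotient F G _ (P.dressingAction i)

/-- The projection from `G` to `F \ G`. -/
def toTarget {F : Type*} [Group F] (i : F →* D) (g : G) : P.Target i :=
  @Quotient.mk _ (@MulAction.orbitRel F G _ (P.dressingAction i)) g

/-- The gauge transform `f ▷ g` of a field `g` by a field `f`. -/
def gauge {F : Type*} [Group F] (i : F →* D) (f : Worldsheet → F) (g : Worldsheet → G) :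
    Worldsheet → G :=
  fun z => P.dress (i (f z)) (g z)

/-- `∂_u g g⁻¹` for a field `g` with values in `G`, as an element of the Lie algebra of `G` inside
that of `D`. -/
def current (g : Worldsheet → G) (z u : Worldsheet) : P.alg :=
  ⟨dHom E EG P.inG (logDeriv EG g z u), LinearMap.mem_range_self _ _⟩

/-- The Lagrangian of the `σ`-model on `G` with density `ℓ g (∂₋g g⁻¹) (∂₊g g⁻¹)`. -/
def lagrangian (ℓ : G → P.alg → P.alg → ℝ) (g : Worldsheet → G) (z : Worldsheet) : ℝ :=
  ℓ (g z) (P.current g z dirMinus) (P.current g z dirPlus)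

/-- The action on the region `K` of the world-sheet. -/
def action (ℓ : G → P.alg → P.alg → ℝ) (K : Set Worldsheet) (g : Worldsheet → G) : ℝ :=
  (1 / 2) * ∫ z in K, P.lagrangian ℓ g z

/-- Gauge invariance under the dressing action of `F` of the `σ`-model on `G` with density `ℓ`,
where `ℓ g` is defined for those `g` only which satisfy `adm`. -/
structure GaugeInvariant {EF : Type*} [NormedAddCommGroup EF] [NormedSpace ℝ EF]
    {F : Type*} [TopologicalSpace F] [ChartedSpace EF F] [Group F]
    (i : F →* D) (adm : G → Prop) (ℓ : G → P.alg → P.alg → ℝ) : Prop where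
  /-- The dressing action preserves the points at which the density is defined. -/
  adm_iff : ∀ (f : F) (g : G), adm (P.dress (i f) g) ↔ adm g
  /-- Gauge transforms of smooth fields are smooth. -/
  isField : ∀ (f : Worldsheet → F) (g : Worldsheet → G),
    IsField EF f → IsField EG g → IsField EG (P.gauge i f g)
  /-- A field and its gauge transforms define the same field with values in `F \ G`. -/
  toTarget_eq : ∀ (f : Worldsheet → F) (g : Worldsheet → G) (z : Worldsheet),
    P.toTarget i (P.gauge i f g z) = P.toTarget i (g z)
  /-- The action is gauge invariant. -/
  action_eq : ∀ (K : Set Worldsheet) (f : Worldsheet → F) (g : Worldsheet → G),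
    IsCompact K → IsGaugeTransformation EF K f → IsField EG g → (∀ z ∈ K, adm (g z)) →
      IntegrableOn (P.lagrangian ℓ g) K ∧ IntegrableOn (P.lagrangian ℓ (P.gauge i f g)) K ∧
        P.action ℓ K (P.gauge i f g) = P.action ℓ K g
  /-- The metric `v ↦ ℓ g v v` of the target is gauge invariant, pointwise and for arbitrary smooth
  gauge transformations; so it is degenerate along the orbits of `F` and lives on `F \ G`. -/
  metric_eq : ∀ (f : Worldsheet → F) (g : Worldsheet → G) (z u : Worldsheet),
    IsField EF f → IsField EG g → adm (g z) →
      ℓ (P.gauge i f g z) (P.current (P.gauge i f g) z u) (P.current (P.gauge i f g) z u) =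
        ℓ (g z) (P.current g z u) (P.current g z u)

/-! ### Standard dressing cosets -/

/-- `R + Π^g`, for `R` defined everywhere. -/
def background (R : P.dualAlg ≃ₗ[ℝ] P.alg) (g : G) : P.dualAlg →ₗ[ℝ] P.alg :=
  R.toLinearMap + P.poisson g

/-- The density `⟨b | (R + Π^g)⁻¹ a⟩`; it is used where `R + Π^g` is bijective. -/
def density (R : P.dualAlg ≃ₗ[ℝ] P.alg) (g : G) (b a : P.alg) : ℝ :=
  P.form b (Function.invFun (P.background R g) a : P.dualAlg)

/-- `{γ + R γ : γ ∈ Ker (R + R*)}`. -/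
def fSpace (R Rs : P.dualAlg →ₗ[ℝ] P.alg) : Submodule ℝ (Lie E D) :=
  (LinearMap.ker (R + Rs)).map (P.dualAlg.subtype + P.alg.subtype ∘ₗ R)

/-- `J Ad_f Ĵ + J [Ad_f, R] Ĵ = R Ad_f R` for all `f ∈ F`. -/
def Condition {F : Type*} [Group F] (i : F →* D) (R : P.dualAlg →ₗ[ℝ] P.alg) : Prop :=
  ∀ (f : F) (x : P.dualAlg),
    P.J (Ad E (i f) x) + (P.J (Ad E (i f) (R x)) - R (P.Jhat (Ad E (i f) x))) =
      R (P.Jhat (Ad E (i f) (R x)))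

/-! ### Generalized dressing cosets -/

/-- `Rs = R*` is the adjoint of `R : Dom R → Im R` with respect to the form, as an operator on
`Dom R` with values in `Im R`. -/
structure IsAdjoint (R Rs : P.dualAlg →ₗ.[ℝ] P.alg) : Prop where
  domain_eq : Rs.domain = R.domain
  range_le : imP Rs ≤ imP R
  adjoint : ∀ (x : R.domain) (y : Rs.domain),
    P.form (R x) (y : P.dualAlg) = P.form (x : P.dualAlg) (Rs y)

/-- The annihilator, in the Lie algebra of `Ĝ`, of a subspace of the Lie algebra of `G`. -/
def ann (S : Submodule ℝ P.alg) : Submodule ℝ P.dualAlg where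
  carrier := {x | ∀ k ∈ S, P.form x k = 0}
  add_mem' := fun ha hb k hk => by simp [ha k hk, hb k hk]
  zero_mem' := fun k _ => by simp
  smul_mem' := fun c x hx k hk => by simp [hx k hk]

/-- A pair of operators `R` and `R̂` with their adjoints, subject to the requirements of the
generalized dressing cosets. -/
structure OperatorPair where
  R : P.dualAlg →ₗ.[ℝ] P.alg
  Rs : P.dualAlg →ₗ.[ℝ] P.alg
  Rhat : P.alg →ₗ.[ℝ] P.dualAlg
  Rhats : P.alg →ₗ.[ℝ] P.dualAlg
  isAdjoint : P.IsAdjoint R Rs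
  isAdjoint_hat : P.swap.IsAdjoint Rhat Rhats
  ker_eq : kerP R = kerP Rs
  ker_hat_eq : kerP Rhat = kerP Rhats
  im_hat_le : imP Rhat ≤ R.domain
  im_le : imP R ≤ Rhat.domain
  /-- `R̂ R = 1` on `Im R̂`. -/
  left_inv : ∀ (x : P.dualAlg) (hx : x ∈ imP Rhat),
    Rhat ⟨R ⟨x, im_hat_le hx⟩, im_le (mem_imP R _)⟩ = x
  /-- `R R̂ = 1` on `Im R`. -/
  right_inv : ∀ (y : P.alg) (hy : y ∈ imP R),
    R ⟨Rhat ⟨y, im_le hy⟩, im_hat_le (mem_imP Rhat _)⟩ = y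
  ann_ker_hat : P.ann (kerP Rhat) = R.domain
  ann_ker : P.swap.ann (kerP R) = Rhat.domain
  nondegenerate : (P.form.restrict
    ((imP R).map P.alg.subtype ⊔ (imP Rhat).map P.dualAlg.subtype)).Nondegenerate

/-- `γ ↦ γ + R γ` on `Dom R`. -/
def graphMap (R : P.dualAlg →ₗ.[ℝ] P.alg) : R.domain →ₗ[ℝ] Lie E D :=
  P.dualAlg.subtype ∘ₗ R.domain.subtype + P.alg.subtype ∘ₗ R.toFun

variable {P} in
/-- `Ker R̂ ⊕ {γ + R γ : γ ∈ Ker (R + R*)}`. -/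
def OperatorPair.fSpace (X : P.OperatorPair) : Submodule ℝ (Lie E D) :=
  (kerP X.Rhat).map P.alg.subtype ⊔
    ((kerP (X.R + X.Rs)).comap X.R.domain.subtype).map (P.graphMap X.R)

/-- `J Ad_f Ĵ + J [Ad_f, R] Ĵ = R Ad_f R` on `Dom R`, for all `f ∈ F`. The two terms
`R Ĵ Ad_f x` and `R Ĵ Ad_f R x` are collected on the right, and only their sum has to be defined. -/
def PartialCondition {F : Type*} [Group F] (i : F →* D) (R : P.dualAlg →ₗ.[ℝ] P.alg) : Prop :=
  ∀ (f : F) (x : R.domain),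
    ∃ h : P.Jhat (Ad E (i f) (x : P.dualAlg)) + P.Jhat (Ad E (i f) (R x)) ∈ R.domain,
      P.J (Ad E (i f) (x : P.dualAlg)) + P.J (Ad E (i f) (R x)) = R ⟨_, h⟩

/-- `ρ` is a projector onto `Im R ⊕ A` with kernel `Ker R̂`, where `A` is a complement of
`Dom R̂`. -/
def IsRho (R : P.dualAlg →ₗ.[ℝ] P.alg) (Rhat : P.alg →ₗ.[ℝ] P.dualAlg)
    (ρ : P.alg →ₗ[ℝ] P.alg) : Prop :=
  ρ ∘ₗ ρ = ρ ∧ LinearMap.ker ρ = kerP Rhat ∧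
    ∃ A : Submodule ℝ P.alg, IsCompl Rhat.domain A ∧ LinearMap.range ρ = imP R ⊔ A

/-- `R + ρ ∘ Π^g` on `Dom R`. -/
def genBackground (R : P.dualAlg →ₗ.[ℝ] P.alg) (ρ : P.alg →ₗ[ℝ] P.alg) (g : G) :
    R.domain →ₗ[ℝ] P.alg :=
  R.toFun + ρ ∘ₗ P.poisson g ∘ₗ R.domain.subtype

/-- `R + ρ ∘ Π^g` is invertible as a map from `Dom R` to the image of `ρ`. -/
def GenAdmissible (R : P.dualAlg →ₗ.[ℝ] P.alg) (ρ : P.alg →ₗ[ℝ] P.alg) (g : G) : Prop :=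
  Function.Injective (P.genBackground R ρ g) ∧
    LinearMap.range (P.genBackground R ρ g) = LinearMap.range ρ

/-- The density `⟨ρ b | (R + ρ ∘ Π^g)⁻¹ ρ a⟩`; it is used where `R + ρ ∘ Π^g` is invertible. -/
def genDensity (R : P.dualAlg →ₗ.[ℝ] P.alg) (ρ : P.alg →ₗ[ℝ] P.alg) (g : G) (b a : P.alg) : ℝ :=
  P.form (ρ b) ((Function.invFun (P.genBackground R ρ g) (ρ a) : R.domain) : P.dualAlg)

/-! ### The models of Sfetsos -/

section Sfetsos

variable {α μ : Type*} [Fintype α] [Fintype μ] [DecidableEq α] [DecidableEq μ]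

variable {P} in
/-- The operators of Sfetsos' models, in dual bases `t_i` and `T^i`, where `i` is an index
`inl α` or `inr M`: `Ker R = Ker (R + R*) = 0`, `Ker R̂ = Ker (R̂ + R̂*) = Span (t_α)`,
`Im R = Span (t_M)`, `Im R̂ = Span (T^M)`, and `R T^M = ∑ R^{MN} t_N`. -/
structure OperatorPair.IsSfetsos (X : P.OperatorPair) (t : Module.Basis (α ⊕ μ) ℝ P.alg)
    (T : Module.Basis (α ⊕ μ) ℝ P.dualAlg) (Rm : Matrix μ μ ℝ) : Prop where
  ker_eq_bot : kerP X.R = ⊥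
  ker_add_eq_bot : kerP (X.R + X.Rs) = ⊥
  ker_hat_eq : kerP X.Rhat = kerP (X.Rhat + X.Rhats)
  dual : ∀ i j, P.form (t i) (T j) = if i = j then 1 else 0
  ker_hat_eq_span : kerP X.Rhat = Submodule.span ℝ (Set.range fun a => t (Sum.inl a))
  im_eq_span : imP X.R = Submodule.span ℝ (Set.range fun M => t (Sum.inr M))
  im_hat_eq_span : imP X.Rhat = Submodule.span ℝ (Set.range fun M => T (Sum.inr M))
  matrix : ∀ M, ∃ h : T (Sum.inr M) ∈ X.R.domain,
    X.R ⟨T (Sum.inr M), h⟩ = ∑ N, Rm M N • t (Sum.inr N)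

/-- The components `Π(g)^{ij}` defined by `Π^g T^i = ∑ Π(g)^{ij} t_j`. -/
def poissonMatrix {ι : Type*} (T : ι → P.dualAlg) (g : G) : Matrix ι ι ℝ :=
  Matrix.of fun i j => P.form (P.poisson g (T i)) (T j)

/-- The density `∑ a^i (O⁻¹)_{ij} b^j` with `a^i = ⟨a | T^i⟩` and `b^j = ⟨b | T^j⟩`. -/
def matrixDensity {ι : Type*} [Fintype ι] [DecidableEq ι] (T : ι → P.dualAlg)
    (O : G → Matrix ι ι ℝ) (g : G) (b a : P.alg) : ℝ :=
  ∑ i, ∑ j, P.form a (T i) * (O g)⁻¹ i j * P.form b (T j)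

/-- The matrix `(R + Π(g))^{MN}` of the model of Sfetsos on `G`. -/
def sfetsosMatrix (T : α ⊕ μ → P.dualAlg) (Rm : Matrix μ μ ℝ) (g : G) : Matrix μ μ ℝ :=
  Rm + P.poissonMatrix (fun M => T (Sum.inr M)) g

/-- The matrix of the dual model of Sfetsos, on `Ĝ`: the blocks of `Π̂(ĝ)`, with the inverse matrix
of `R^{MN}` added to the block `MN`. -/
def sfetsosDualMatrix (t : α ⊕ μ → P.alg) (Rm : Matrix μ μ ℝ) (g : H) :
    Matrix (α ⊕ μ) (α ⊕ μ) ℝ :=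
  P.swap.poissonMatrix t g + Matrix.fromBlocks 0 0 0 Rm⁻¹

end Sfetsos

end PerfectDouble

end Double

end DressingCosets

end

/-!
The Lagrangian of each of the models is `⟨b | e⟩` for the components `a`, `b` of the current, where
`e` is the projection of `a` onto a subspace `S` of the Lie algebra of `D` along `Ad_g 𝒢̂`. The
subspace `S` is invariant under `Ad_F`, and it contains the Lie algebra of `F` and is orthogonal to
it. Under a gauge transformation `f`, with `f g = g' ĥ`, the projection becomes `Ad_f e + ∂f f⁻¹`:
hence the target metric is invariant at each point, and the Lagrangian changes by half the
difference of the Polyakov–Wiegmann 2-forms of the two factorizations `f g = g' ĥ`. By the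
Polyakov–Wiegmann identity this difference is closed, since the Cartan 3-form vanishes on isotropic
subgroups, so that by Stokes' theorem its integral is constant along the homotopy from `f` to `1`.
Duality exchanges the roles of `G` and `Ĝ` and preserves `S`, which therefore serves the model and
its dual alike.
-/

namespace DressingCosets

open Filter Topology

noncomputable section

/-! ### Right logarithmic derivatives and the Polyakov–Wiegmann identity -/

section Calculus

variable {E : Type*} [NormedAddCommGroup E] [NormedSpace ℝ E]
  {D : Type*} [TopologicalSpace D] [ChartedSpace E D] [Group D]
  {M : Type*} [NormedAddCommGroup M] [NormedSpace ℝ M]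

/-- The norm of the model space, transported to the Lie algebra. -/
@[reducible] def lieNormedAddCommGroup : NormedAddCommGroup (Lie E D) :=
  inferInstanceAs (NormedAddCommGroup E)

attribute [local instance] lieNormedAddCommGroup

/-- The normed space structure of the model space, transported to the Lie algebra. -/
@[reducible] def lieNormedSpace : NormedSpace ℝ (Lie E D) :=
  inferInstanceAs (NormedSpace ℝ E)

attribute [local instance] lieNormedSpace

/-- The norm topology of the Lie algebra. -/
@[reducible] def lieTop : TopologicalSpace (Lie E D) :=
  UniformSpace.toTopologicalSpace

attribute [local instance] lieTop

variable (E) in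
/-- Smoothness at a point of a map from a normed space to a manifold modelled on `E`. -/
abbrev SmoothAt {D : Type*} [TopologicalSpace D] [ChartedSpace E D] (φ : M → D) (z : M) : Prop :=
  ContMDiffAt 𝓘(ℝ, M) 𝓘(ℝ, E) ∞ φ z

variable (E) in
/-- The right logarithmic derivative `dφ φ⁻¹` at `z` of a map from a normed space to a Lie group. -/
def rlogDeriv (φ : M → D) (z : M) : M →L[ℝ] Lie E D :=
  mfderiv 𝓘(ℝ, M) 𝓘(ℝ, E) (fun w => φ w * (φ z)⁻¹) z

variable (E) in
/-- The preferred chart at `1`, as a chart with values in the Lie algebra, which is the model space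
by definition. -/
def unitChart (D : Type*) [TopologicalSpace D] [ChartedSpace E D] [Group D] :
    OpenPartialHomeomorph D (Lie E D) := chartAt E (1 : D)

theorem rlogDeriv_const (d : D) (z : M) : rlogDeriv E (fun _ : M => d) z = 0 :=
  mfderiv_const

theorem rlogDeriv_congr {φ ψ : M → D} {z : M} (h : φ =ᶠ[𝓝 z] ψ) :
    rlogDeriv E φ z = rlogDeriv E ψ z := by
  unfold rlogDeriv
  rw [h.eq_of_nhds]
  exact Filter.EventuallyEq.mfderiv_eq (h.fun_comp (· * (ψ z)⁻¹))

theorem rlogDeriv_eq_mfderiv {φ ψ : M → D} {z : M} (h : ∀ w, φ w * (φ z)⁻¹ = ψ w) :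
    rlogDeriv E φ z = mfderiv 𝓘(ℝ, M) 𝓘(ℝ, E) ψ z :=
  mfderiv_congr (funext h)

theorem rlogDeriv_mul_const (φ : M → D) (d : D) (z : M) :
    rlogDeriv E (fun w => φ w * d) z = rlogDeriv E φ z :=
  rlogDeriv_eq_mfderiv fun w => by group

theorem unitChart_symm_one : (unitChart E D).symm (unitChart E D 1) = 1 :=
  (chartAt E (1 : D)).left_inv (mem_chart_source E 1)

variable [LieGroup 𝓘(ℝ, E) ∞ D]

theorem mdifferentiableAt_mul_inv {φ : M → D} {z : M}
    (hφ : MDifferentiableAt 𝓘(ℝ, M) 𝓘(ℝ, E) φ z) :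
    MDifferentiableAt 𝓘(ℝ, M) 𝓘(ℝ, E) (fun w => φ w * (φ z)⁻¹) z :=
  ((contMDiff_mul_right (I := 𝓘(ℝ, E)) (n := ∞)).mdifferentiableAt (by simp)).comp z hφ

theorem SmoothAt.mdifferentiableAt_mul_inv {φ : M → D} {z : M} (hφ : SmoothAt E φ z) :
    MDifferentiableAt 𝓘(ℝ, M) 𝓘(ℝ, E) (fun w => φ w * (φ z)⁻¹) z :=
  DressingCosets.mdifferentiableAt_mul_inv (hφ.mdifferentiableAt (by simp))

omit [Group D] [LieGroup 𝓘(ℝ, E) ∞ D] in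
theorem SmoothAt.comp_contDiffAt {M' : Type*} [NormedAddCommGroup M'] [NormedSpace ℝ M'] {φ : M → D}
    {j : M' → M} {z : M'} (hφ : SmoothAt E φ (j z)) (hj : ContDiffAt ℝ ∞ j z) :
    SmoothAt E (fun w => φ (j w)) z :=
  ContMDiffAt.comp z hφ hj.contMDiffAt

theorem SmoothAt.mul_smoothAt {φ ψ : M → D} {z : M} (hφ : SmoothAt E φ z) (hψ : SmoothAt E ψ z) :
    SmoothAt E (fun w => φ w * ψ w) z :=
  ContMDiffAt.mul hφ hψ

theorem SmoothAt.conj {φ : M → D} {z : M} (hφ : SmoothAt E φ z) (d : D) :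
    SmoothAt E (fun w => d * φ w * d⁻¹) z :=
  (contMDiffAt_const.mul hφ).mul contMDiffAt_const

theorem rlogDeriv_comp {M' : Type*} [NormedAddCommGroup M'] [NormedSpace ℝ M'] {φ : M → D}
    {j : M' → M} {z : M'} (hφ : SmoothAt E φ (j z)) (hj : DifferentiableAt ℝ j z) :
    rlogDeriv E (fun w => φ (j w)) z = (rlogDeriv E φ (j z)).comp (fderiv ℝ j z) := by
  rw [← mfderiv_eq_fderiv]
  exact mfderiv_comp z hφ.mdifferentiableAt_mul_inv hj.mdifferentiableAt

omit [LieGroup 𝓘(ℝ, E) ∞ D] in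
theorem rlogDeriv_hom {E' : Type*} [NormedAddCommGroup E'] [NormedSpace ℝ E']
    {S : Type*} [TopologicalSpace S] [ChartedSpace E' S] [Group S] [LieGroup 𝓘(ℝ, E') ∞ S]
    {i : S →* D} (hi : ContMDiff 𝓘(ℝ, E') 𝓘(ℝ, E) ∞ i)
    {φ : M → S} {z : M} (hφ : SmoothAt E' φ z) (u : M) :
    rlogDeriv E (fun w => i (φ w)) z u = dHom E E' i (rlogDeriv E' φ z u) := by
  rw [rlogDeriv_eq_mfderiv (ψ := i ∘ fun w => φ w * (φ z)⁻¹) fun w => by simp]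
  exact mfderiv_comp_apply_of_eq z (hi.mdifferentiableAt (by simp)) hφ.mdifferentiableAt_mul_inv
    (mul_inv_cancel (φ z)) u

theorem rlogDeriv_conj (d : D) {φ : M → D} {z : M} (hφ : SmoothAt E φ z) (u : M) :
    rlogDeriv E (fun w => d * φ w * d⁻¹) z u = Ad E d (rlogDeriv E φ z u) :=
  rlogDeriv_hom (i := (MulAut.conj d).toMonoidHom)
    ((contMDiff_const.mul contMDiff_id).mul contMDiff_const) hφ u

theorem mfderiv_mul_one_one (x y : Lie E D) :
    mfderiv (𝓘(ℝ, E).prod 𝓘(ℝ, E)) 𝓘(ℝ, E) (fun p : D × D => p.1 * p.2) (1, 1) (x, y) = x + y := by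
  have hmul := (contMDiff_mul 𝓘(ℝ, E) ∞ (G := D)).mdifferentiableAt (x := (1, 1)) (by simp)
  refine (mfderiv_prod_eq_add_apply hmul).trans (congrArg₂ (· + ·) ?_ ?_)
  · exact DFunLike.congr_fun ((mfderiv_congr (funext mul_one)).trans mfderiv_id) x
  · exact DFunLike.congr_fun ((mfderiv_congr (funext one_mul)).trans mfderiv_id) y

theorem rlogDeriv_mul {φ ψ : M → D} {z : M} (hφ : SmoothAt E φ z) (hψ : SmoothAt E ψ z) (u : M) :
    rlogDeriv E (fun w => φ w * ψ w) z u = rlogDeriv E φ z u + Ad E (φ z) (rlogDeriv E ψ z u) := by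
  have hconj := hψ.conj (φ z)
  rw [← rlogDeriv_conj _ hψ, ← mfderiv_mul_one_one,
    rlogDeriv_eq_mfderiv (ψ := (fun p : D × D => p.1 * p.2) ∘ fun w =>
      (φ w * (φ z)⁻¹, φ z * ψ w * (φ z)⁻¹ * (φ z * ψ z * (φ z)⁻¹)⁻¹)) fun w => by
        simp only [Function.comp_apply]; group]
  refine (mfderiv_comp_apply_of_eq z ((contMDiff_mul 𝓘(ℝ, E) ∞).mdifferentiableAt (by simp))
    (hφ.mdifferentiableAt_mul_inv.prodMk hconj.mdifferentiableAt_mul_inv)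
    (y := (1, 1)) (by simp only [mul_inv_cancel]) u).trans (congrArg _ ?_)
  exact DFunLike.congr_fun
    (hφ.mdifferentiableAt_mul_inv.mfderiv_prod hconj.mdifferentiableAt_mul_inv) u

theorem isManifold_of_lieGroup : IsManifold 𝓘(ℝ, E) ∞ D :=
  (inferInstance : ContMDiffMul 𝓘(ℝ, E) ∞ D).toIsManifold

theorem SmoothAt.contDiffAt_unitChart {φ : M → D} {z : M} (hφ : SmoothAt E φ z) (h1 : φ z = 1) :
    ContDiffAt ℝ ∞ (fun w => unitChart E D (φ w)) z := by
  have := isManifold_of_lieGroup (E := E) (D := D)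
  have h : ContMDiffAt 𝓘(ℝ, E) 𝓘(ℝ, E) ∞ (chartAt E (1 : D)) (φ z) := by
    rw [h1]; exact contMDiffAt_extChartAt
  exact (h.comp z hφ).contDiffAt

theorem rlogDeriv_eq_fderiv {φ : M → D} {z : M} (hφ : MDifferentiableAt 𝓘(ℝ, M) 𝓘(ℝ, E) φ z) :
    rlogDeriv E φ z = fderiv ℝ (fun w => unitChart E D (φ w * (φ z)⁻¹)) z := by
  rw [rlogDeriv, (mdifferentiableAt_mul_inv hφ).mfderiv]
  simp only [writtenInExtChartAt, mul_inv_cancel, unitChart, extChartAt, Function.comp_def,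
    mfld_simps, fderivWithin_univ]
  rfl

theorem SmoothAt.eventually_mdifferentiableAt {φ : M → D} {z : M} (hφ : SmoothAt E φ z) :
    ∀ᶠ w in 𝓝 z, MDifferentiableAt 𝓘(ℝ, M) 𝓘(ℝ, E) φ w := by
  have := isManifold_of_lieGroup (E := E) (D := D)
  have : IsManifold 𝓘(ℝ, E) 1 D := .of_le (n := ∞) (by decide)
  have h := (contMDiffAt_iff_contMDiffAt_nhds (n := 1) (by simp)).1 (hφ.of_le (by simp))
  exact h.mono fun w hw => hw.mdifferentiableAt one_ne_zero

theorem contDiffAt_rlogDeriv {φ : M → D} {z : M} (hφ : SmoothAt E φ z) :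
    ContDiffAt ℝ ∞ (rlogDeriv E φ) z := by
  have hquot : SmoothAt E (fun p : M × M => φ p.2 * (φ p.1)⁻¹) (z, z) :=
    (hφ.comp_contDiffAt (j := Prod.snd) (z := (z, z)) contDiffAt_snd).mul_smoothAt
      (hφ.comp_contDiffAt (j := Prod.fst) (z := (z, z)) contDiffAt_fst).inv
  have hchart := hquot.contDiffAt_unitChart (mul_inv_cancel _)
  refine (ContDiffAt.fderiv (f := fun w x => unitChart E D (φ x * (φ w)⁻¹)) (g := id)
    hchart contDiffAt_id (by simp)).congr_of_eventuallyEq ?_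
  exact hφ.eventually_mdifferentiableAt.mono fun w => rlogDeriv_eq_fderiv

theorem eventually_smoothAt_unitChart_symm :
    ∀ᶠ x in 𝓝 (unitChart E D 1), SmoothAt E (unitChart E D).symm x := by
  have : IsManifold 𝓘(ℝ, E) ∞ D := isManifold_of_lieGroup
  filter_upwards [(chartAt E (1 : D)).open_target.mem_nhds (mem_chart_target E 1)] with x hx
  exact (contMDiffOn_chart_symm (I := 𝓘(ℝ, E))).contMDiffAt
    ((chartAt E (1 : D)).open_target.mem_nhds hx)

theorem rlogDeriv_unitChart_symm (y : Lie E D) :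
    rlogDeriv E (unitChart E D).symm (unitChart E D 1) y = y := by
  rw [rlogDeriv_eq_fderiv
      (eventually_smoothAt_unitChart_symm.self_of_nhds.mdifferentiableAt (by simp)),
    unitChart_symm_one]
  have h : (fun x => unitChart E D ((unitChart E D).symm x * 1⁻¹)) =ᶠ[𝓝 (unitChart E D 1)] id := by
    filter_upwards [(chartAt E (1 : D)).open_target.mem_nhds (mem_chart_target E 1)] with x hx
    rw [inv_one, mul_one]
    exact (chartAt E (1 : D)).right_inv hx
  rw [h.fderiv_eq, fderiv_id]
  rfl

variable (E D) in
/-- The right-invariant Maurer–Cartan form, read in the chart at `1`. -/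
def mcForm (x : Lie E D) : Lie E D →L[ℝ] Lie E D :=
  rlogDeriv E (unitChart E D).symm x

variable (E D) in
/-- The Lie bracket. It is encoded as the exterior derivative of the Maurer–Cartan form at `1`, in
the sign convention `[a, b] = ab - ba` for which the Maurer–Cartan equation of right logarithmic
derivatives reads `d(dφ φ⁻¹)(u, v) = [dφ φ⁻¹ u, dφ φ⁻¹ v]`. -/
def bracket (a b : Lie E D) : Lie E D :=
  fderiv ℝ (mcForm E D) (unitChart E D 1) a b - fderiv ℝ (mcForm E D) (unitChart E D 1) b a

theorem rlogDeriv_eventuallyEq_mcForm {φ : M → D} {z : M} (hφ : SmoothAt E φ z) :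
    ∀ᶠ w in 𝓝 z, rlogDeriv E φ w = (mcForm E D (unitChart E D (φ w * (φ z)⁻¹))).comp
      (fderiv ℝ (fun w => unitChart E D (φ w * (φ z)⁻¹)) w) := by
  have hquot : SmoothAt E (fun w => φ w * (φ z)⁻¹) z := ContMDiffAt.mul hφ contMDiffAt_const
  have hchart := hquot.contDiffAt_unitChart (mul_inv_cancel _)
  have hleft : ∀ᶠ w in 𝓝 z, φ w * (φ z)⁻¹ ∈ (unitChart E D).source := by
    refine hquot.continuousAt.preimage_mem_nhds ((unitChart E D).open_source.mem_nhds ?_)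
    rw [mul_inv_cancel]
    exact mem_chart_source E 1
  have hdiff : ∀ᶠ w in 𝓝 z, DifferentiableAt ℝ (fun w => unitChart E D (φ w * (φ z)⁻¹)) w :=
    ((hchart.of_le (by simp : (1 : ℕ∞ω) ≤ ∞)).eventually (by simp)).mono
      fun w hw => hw.differentiableAt one_ne_zero
  have hsymm : ∀ᶠ w in 𝓝 z, SmoothAt E (unitChart E D).symm (unitChart E D (φ w * (φ z)⁻¹)) := by
    refine hchart.continuousAt.eventually ?_
    simp only [mul_inv_cancel]
    exact eventually_smoothAt_unitChart_symm
  filter_upwards [hleft.eventually_nhds, hdiff, hsymm] with w hleft hdiff hsymm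
  rw [mcForm, ← rlogDeriv_comp (j := fun w => unitChart E D (φ w * (φ z)⁻¹)) hsymm hdiff,
    ← rlogDeriv_mul_const φ (φ z)⁻¹]
  exact rlogDeriv_congr (hleft.mono fun x hx => ((unitChart E D).left_inv hx).symm)

theorem maurerCartan_equation {φ : M → D} {z : M} (hφ : SmoothAt E φ z) (u v : M) :
    fderiv ℝ (fun w => rlogDeriv E φ w v) z u - fderiv ℝ (fun w => rlogDeriv E φ w u) z v =
      bracket E D (rlogDeriv E φ z u) (rlogDeriv E φ z v) := by
  have hdiff := (contDiffAt_rlogDeriv hφ).differentiableAt (by simp)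
  have hmc : DifferentiableAt ℝ (mcForm E D) (unitChart E D (φ z * (φ z)⁻¹)) := by
    rw [mul_inv_cancel]
    exact (contDiffAt_rlogDeriv eventually_smoothAt_unitChart_symm.self_of_nhds).differentiableAt
      (by simp)
  have hquot : SmoothAt E (fun w => φ w * (φ z)⁻¹) z := ContMDiffAt.mul hφ contMDiffAt_const
  have hchart := hquot.contDiffAt_unitChart (mul_inv_cancel _)
  have hcoord := (hchart.differentiableAt (by simp)).hasFDerivAt
  have hcoord' := ((hchart.fderiv_right (m := ∞) (by simp)).differentiableAt (by simp)).hasFDerivAt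
  have hsymm := ((contDiffAt_infty.1 hchart 2).isSymmSndFDerivAt (by simp)).eq u v
  have key := ((hmc.hasFDerivAt.comp z hcoord).clm_comp hcoord').congr_of_eventuallyEq
    (rlogDeriv_eventuallyEq_mcForm hφ)
  rw [fderiv_clm_apply hdiff (by fun_prop), fderiv_clm_apply hdiff (by fun_prop), key.fderiv,
    rlogDeriv_eq_fderiv (hφ.mdifferentiableAt (by simp)), bracket]
  simp [hsymm, mcForm, rlogDeriv_unitChart_symm]

section Adjoint

theorem Ad_eq_rlogDeriv (d : D) (y : Lie E D) :
    Ad E d y = rlogDeriv E (fun x => d * (unitChart E D).symm x * d⁻¹) (unitChart E D 1) y := by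
  rw [rlogDeriv_conj d eventually_smoothAt_unitChart_symm.self_of_nhds, rlogDeriv_unitChart_symm]

theorem Ad_mul (d d' : D) (y : Lie E D) : Ad E (d * d') y = Ad E d (Ad E d' y) := by
  have hsymm := (eventually_smoothAt_unitChart_symm (E := E) (D := D)).self_of_nhds
  rw [Ad_eq_rlogDeriv d', ← rlogDeriv_conj d (hsymm.conj d'),
    Ad_eq_rlogDeriv]
  simp only [mul_inv_rev, mul_assoc]

theorem Ad_one (y : Lie E D) : Ad E (1 : D) y = y := by
  simp only [Ad_eq_rlogDeriv, one_mul, inv_one, mul_one, rlogDeriv_unitChart_symm]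

theorem Ad_inv_Ad (d : D) (y : Lie E D) : Ad E d⁻¹ (Ad E d y) = y := by
  rw [← Ad_mul, inv_mul_cancel, Ad_one]

theorem Ad_Ad_inv (d : D) (y : Lie E D) : Ad E d (Ad E d⁻¹ y) = y := by
  rw [← Ad_mul, mul_inv_cancel, Ad_one]

omit [LieGroup 𝓘(ℝ, E) ∞ D] in
theorem bracket_swap (a b : Lie E D) : bracket E D a b = -bracket E D b a :=
  (neg_sub _ _).symm

omit [LieGroup 𝓘(ℝ, E) ∞ D] in
theorem bracket_sub_left (a b c : Lie E D) :
    bracket E D (a - b) c = bracket E D a c - bracket E D b c := by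
  simp [bracket]; abel

omit [LieGroup 𝓘(ℝ, E) ∞ D] in
theorem bracket_sub_right (a b c : Lie E D) :
    bracket E D a (b - c) = bracket E D a b - bracket E D a c := by
  simp [bracket]; abel

theorem rlogDeriv_mul_unitChart_symm {φ : M → D} {w : M} {x : Lie E D} (hφ : SmoothAt E φ w)
    (hx : SmoothAt E (unitChart E D).symm x) (u : M) (y : Lie E D) :
    rlogDeriv E (fun p : M × Lie E D => φ p.1 * (unitChart E D).symm p.2) (w, x) (u, y) =
      rlogDeriv E φ w u + Ad E (φ w) (mcForm E D x y) := by
  rw [rlogDeriv_mul (hφ.comp_contDiffAt (z := (w, x)) contDiffAt_fst)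
      (hx.comp_contDiffAt (z := (w, x)) contDiffAt_snd),
    rlogDeriv_comp (j := Prod.fst) hφ differentiableAt_fst,
    rlogDeriv_comp (j := Prod.snd) hx differentiableAt_snd, fderiv_fst, fderiv_snd]
  rfl

theorem Ad_eventuallyEq_rlogDeriv_mul {φ : M → D} {z : M} (hφ : ∀ᶠ w in 𝓝 z, SmoothAt E φ w)
    (y : Lie E D) :
    (fun w => Ad E (φ w) y) =ᶠ[𝓝 z] fun w =>
      rlogDeriv E (fun p : M × Lie E D => φ p.1 * (unitChart E D).symm p.2)
        (w, unitChart E D 1) (0, y) := by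
  filter_upwards [hφ] with w hw
  rw [rlogDeriv_mul_unitChart_symm hw eventually_smoothAt_unitChart_symm.self_of_nhds, mcForm,
    rlogDeriv_unitChart_symm, map_zero, zero_add]

theorem smoothAt_mul_unitChart_symm {φ : M → D} {z : M} (hφ : SmoothAt E φ z) :
    SmoothAt E (fun p : M × Lie E D => φ p.1 * (unitChart E D).symm p.2) (z, unitChart E D 1) :=
  (hφ.comp_contDiffAt (j := Prod.fst) (z := (z, unitChart E D 1)) contDiffAt_fst).mul_smoothAt
    (eventually_smoothAt_unitChart_symm.self_of_nhds.comp_contDiffAt (j := Prod.snd)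
      (z := (z, unitChart E D 1)) contDiffAt_snd)

theorem contDiffAt_Ad {φ : M → D} {z : M} (hφ : ∀ᶠ w in 𝓝 z, SmoothAt E φ w) (y : Lie E D) :
    ContDiffAt ℝ ∞ (fun w => Ad E (φ w) y) z := by
  have hderiv := contDiffAt_rlogDeriv (smoothAt_mul_unitChart_symm hφ.self_of_nhds)
  exact ((hderiv.comp z (contDiffAt_id.prodMk contDiffAt_const)).clm_apply
    contDiffAt_const).congr_of_eventuallyEq (Ad_eventuallyEq_rlogDeriv_mul hφ y)

theorem fderiv_Ad {φ : M → D} {z : M} (hφ : ∀ᶠ w in 𝓝 z, SmoothAt E φ w) (u : M) (y : Lie E D) :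
    fderiv ℝ (fun w => Ad E (φ w) y) z u = bracket E D (rlogDeriv E φ z u) (Ad E (φ z) y) := by
  -- This is the Maurer–Cartan equation of `(w, x) ↦ φ w * x` in the directions `(u, 0)`, `(0, y)`.
  set e := unitChart E D 1
  set Ψ : M × Lie E D → D := fun p => φ p.1 * (unitChart E D).symm p.2
  have hsymm : ∀ᶠ x in 𝓝 e, SmoothAt E (unitChart E D).symm x := eventually_smoothAt_unitChart_symm
  have hΨ : SmoothAt E Ψ (z, e) := smoothAt_mul_unitChart_symm hφ.self_of_nhds
  have hdiff : ∀ p, DifferentiableAt ℝ (fun q => rlogDeriv E Ψ q p) (z, e) := fun p =>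
    ((contDiffAt_rlogDeriv hΨ).differentiableAt (by simp)).clm_apply (differentiableAt_const p)
  have hfst : fderiv ℝ (fun q => rlogDeriv E Ψ q (0, y)) (z, e) (u, 0) =
      fderiv ℝ (fun w => Ad E (φ w) y) z u := by
    rw [(Ad_eventuallyEq_rlogDeriv_mul hφ y).fderiv_eq]
    exact (DFunLike.congr_fun ((hdiff (0, y)).hasFDerivAt.comp (f := fun w => (w, e)) z
      (hasFDerivAt_prodMk_left z e)).fderiv u).symm
  have hsnd : fderiv ℝ (fun q => rlogDeriv E Ψ q (u, 0)) (z, e) (0, y) = 0 := by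
    have hconst : (fun x => rlogDeriv E Ψ (z, x) (u, 0)) =ᶠ[𝓝 e] fun _ => rlogDeriv E φ z u :=
      hsymm.mono fun x hx => by
        simp only [Ψ]
        rw [rlogDeriv_mul_unitChart_symm hφ.self_of_nhds hx, map_zero, map_zero, add_zero]
    have hcomp := DFunLike.congr_fun ((hdiff (u, 0)).hasFDerivAt.comp (f := fun x => (z, x)) e
      (hasFDerivAt_prodMk_right z e)).fderiv y
    exact hcomp.symm.trans (by rw [Function.comp_def, hconst.fderiv_eq]; simp)
  have hMC := maurerCartan_equation hΨ (u, 0) (0, y)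
  rwa [hfst, hsnd, sub_zero, rlogDeriv_mul_unitChart_symm hφ.self_of_nhds hsymm.self_of_nhds,
    rlogDeriv_mul_unitChart_symm hφ.self_of_nhds hsymm.self_of_nhds, mcForm,
    rlogDeriv_unitChart_symm, rlogDeriv_unitChart_symm, map_zero, map_zero, add_zero, zero_add]
    at hMC

omit [LieGroup 𝓘(ℝ, E) ∞ D] in
theorem fderiv_Ad_apply (d : D) {X : M → Lie E D} {z : M} (hX : DifferentiableAt ℝ X z) (u : M) :
    fderiv ℝ (fun w => Ad E d (X w)) z u = Ad E d (fderiv ℝ X z u) :=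
  let L : Lie E D →L[ℝ] Lie E D := mfderiv 𝓘(ℝ, E) 𝓘(ℝ, E) (fun x : D => d * x * d⁻¹) 1
  DFunLike.congr_fun (L.hasFDerivAt.comp z hX.hasFDerivAt).fderiv u

theorem bracket_Ad (d : D) (a b : Lie E D) :
    bracket E D (Ad E d a) (Ad E d b) = Ad E d (bracket E D a b) := by
  have hsymm := (eventually_smoothAt_unitChart_symm (E := E) (D := D)).self_of_nhds
  have hfderiv (u v : Lie E D) : fderiv ℝ (fun x => rlogDeriv E
        (fun x => d * (unitChart E D).symm x * d⁻¹) x v) (unitChart E D 1) u =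
      Ad E d (fderiv ℝ (mcForm E D) (unitChart E D 1) u v) := by
    have hconj : (fun x => rlogDeriv E (fun x => d * (unitChart E D).symm x * d⁻¹) x v)
        =ᶠ[𝓝 (unitChart E D 1)] fun x => Ad E d (mcForm E D x v) :=
      eventually_smoothAt_unitChart_symm.mono fun x hx => rlogDeriv_conj d hx v
    have hmc : DifferentiableAt ℝ (mcForm E D) (unitChart E D 1) :=
      (contDiffAt_rlogDeriv hsymm).differentiableAt (by simp)
    rw [hconj.fderiv_eq, fderiv_Ad_apply d (hmc.clm_apply (differentiableAt_const v)),
      fderiv_clm_apply hmc (differentiableAt_const v)]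
    simp
  rw [Ad_eq_rlogDeriv d a, Ad_eq_rlogDeriv d b, ← maurerCartan_equation (hsymm.conj d), hfderiv,
    hfderiv, ← map_sub, bracket]

end Adjoint

section InvariantForm

variable {B : Lie E D →L[ℝ] Lie E D →L[ℝ] ℝ}

omit [LieGroup 𝓘(ℝ, E) ∞ D] in
theorem differentiableAt_form {X Y : M → Lie E D} {z : M} (hX : DifferentiableAt ℝ X z)
    (hY : DifferentiableAt ℝ Y z) : DifferentiableAt ℝ (fun w => B (X w) (Y w)) z :=
  (B.differentiableAt.comp z hX).clm_apply hY

omit [LieGroup 𝓘(ℝ, E) ∞ D] in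
theorem fderiv_form {X Y : M → Lie E D} {z : M} (hX : DifferentiableAt ℝ X z)
    (hY : DifferentiableAt ℝ Y z) (u : M) :
    fderiv ℝ (fun w => B (X w) (Y w)) z u =
      B (fderiv ℝ X z u) (Y z) + B (X z) (fderiv ℝ Y z u) := by
  rw [fderiv_clm_apply (c := fun w => B (X w)) (B.differentiableAt.comp z hX) hY]
  have h := (B.hasFDerivAt.comp z hX.hasFDerivAt).fderiv
  simp only [Function.comp_def] at h
  rw [h]
  simp [add_comm]

theorem form_bracket_left_add_right
    (hinv : ∀ (d : D) (x y : Lie E D), B (Ad E d x) (Ad E d y) = B x y) (a b c : Lie E D) :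
    B (bracket E D a b) c + B b (bracket E D a c) = 0 := by
  have hsymm := eventually_smoothAt_unitChart_symm (E := E) (D := D)
  have hdiff (y : Lie E D) :
      DifferentiableAt ℝ (fun x => Ad E ((unitChart E D).symm x) y) (unitChart E D 1) :=
    (contDiffAt_Ad hsymm y).differentiableAt (by simp)
  have h := fderiv_form (B := B) (hdiff b) (hdiff c) a
  simp only [hinv, fderiv_Ad hsymm, rlogDeriv_unitChart_symm, unitChart_symm_one, Ad_one] at h
  simpa using h.symm

variable (B) in
/-- The value at `z` of the Cartan `3`-form `⟨[a, b] | c⟩` pulled back along `φ`. -/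
def cartanForm (φ : M → D) (u v w z : M) : ℝ :=
  B (bracket E D (rlogDeriv E φ z u) (rlogDeriv E φ z v)) (rlogDeriv E φ z w)

variable (B) in
/-- The Polyakov–Wiegmann `2`-form `⟨φ⁻¹ dφ ∧ dψ ψ⁻¹⟩` of two maps to a Lie group. -/
def pwForm (φ ψ : M → D) (u v z : M) : ℝ :=
  B (rlogDeriv E φ z u) (Ad E (φ z) (rlogDeriv E ψ z v)) -
    B (rlogDeriv E φ z v) (Ad E (φ z) (rlogDeriv E ψ z u))

theorem pwForm_eq_mul {φ ψ : M → D} {z : M} (hsymm : ∀ x y, B x y = B y x) (hφ : SmoothAt E φ z)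
    (hψ : SmoothAt E ψ z) (u v : M) :
    pwForm B φ ψ u v z = B (rlogDeriv E φ z u) (rlogDeriv E (fun w => φ w * ψ w) z v) -
      B (rlogDeriv E φ z v) (rlogDeriv E (fun w => φ w * ψ w) z u) := by
  rw [rlogDeriv_mul hφ hψ, rlogDeriv_mul hφ hψ, map_add, map_add, pwForm, hsymm (rlogDeriv E φ z u)
    (rlogDeriv E φ z v)]
  ring

theorem form_bracket_cyclic (hsymm : ∀ x y, B x y = B y x)
    (hinv : ∀ (d : D) (x y : Lie E D), B (Ad E d x) (Ad E d y) = B x y) (a b c : Lie E D) :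
    B (bracket E D a b) c = B (bracket E D b c) a := by
  have h := form_bracket_left_add_right hinv b a c
  rw [bracket_swap b a, map_neg, _root_.neg_apply, hsymm a] at h
  linarith

theorem form_bracket_sub (hsymm : ∀ x y, B x y = B y x)
    (hinv : ∀ (d : D) (x y : Lie E D), B (Ad E d x) (Ad E d y) = B x y)
    (a₁ a₂ a₃ c₁ c₂ c₃ : Lie E D) :
    B (bracket E D (c₁ - a₁) (c₂ - a₂)) (c₃ - a₃) =
      B (bracket E D c₁ c₂) c₃ - B (bracket E D a₁ a₂) a₃ +
      (B (bracket E D a₁ a₂) c₃ - B (bracket E D c₁ c₂) a₃) +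
      (B (bracket E D a₂ a₃) c₁ - B (bracket E D c₂ c₃) a₁) +
      (B (bracket E D a₃ a₁) c₂ - B (bracket E D c₃ c₁) a₂) := by
  have hcyc := form_bracket_cyclic hsymm hinv
  simp only [bracket_sub_left, bracket_sub_right, map_sub, _root_.sub_apply]
  rw [hcyc c₁ a₂ c₃, hcyc a₂ c₃ c₁, hcyc a₁ c₂ c₃, hcyc a₂ a₃ c₁, hcyc a₃ c₁ a₂, hcyc a₃ a₁ c₂,
    hcyc a₁ c₂ a₃]
  ring

/-- The Polyakov–Wiegmann identity. -/
theorem cyclic_fderiv_pwForm {φ ψ : M → D} (hsymm : ∀ x y, B x y = B y x)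
    (hinv : ∀ (d : D) (x y : Lie E D), B (Ad E d x) (Ad E d y) = B x y)
    (hφ : ∀ z, SmoothAt E φ z) (hψ : ∀ z, SmoothAt E ψ z) (u v w z : M) :
    fderiv ℝ (pwForm B φ ψ v w) z u + fderiv ℝ (pwForm B φ ψ w u) z v +
        fderiv ℝ (pwForm B φ ψ u v) z w =
      cartanForm B φ u v w z + cartanForm B ψ u v w z -
        cartanForm B (fun x => φ x * ψ x) u v w z := by
  set χ : M → D := fun x => φ x * ψ x
  have hχ : ∀ z, SmoothAt E χ z := fun z => (hφ z).mul_smoothAt (hψ z)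
  have hdiff {θ : M → D} (hθ : ∀ z, SmoothAt E θ z) (q : M) :
      DifferentiableAt ℝ (fun x => rlogDeriv E θ x q) z :=
    ((contDiffAt_rlogDeriv (hθ z)).differentiableAt (by simp)).clm_apply (differentiableAt_const q)
  have hprod (p q r : M) : fderiv ℝ (pwForm B φ ψ q r) z p =
      (B (fderiv ℝ (fun x => rlogDeriv E φ x q) z p) (rlogDeriv E χ z r) +
        B (rlogDeriv E φ z q) (fderiv ℝ (fun x => rlogDeriv E χ x r) z p)) -
      (B (fderiv ℝ (fun x => rlogDeriv E φ x r) z p) (rlogDeriv E χ z q) +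
        B (rlogDeriv E φ z r) (fderiv ℝ (fun x => rlogDeriv E χ x q) z p)) := by
    rw [funext fun x => pwForm_eq_mul hsymm (hφ x) (hψ x) q r, fderiv_fun_sub, sub_apply,
      fderiv_form (hdiff hφ q) (hdiff hχ r), fderiv_form (hdiff hφ r) (hdiff hχ q)]
    · exact differentiableAt_form (hdiff hφ q) (hdiff hχ r)
    · exact differentiableAt_form (hdiff hφ r) (hdiff hχ q)
  have hψ_eq (q : M) : Ad E (φ z) (rlogDeriv E ψ z q) = rlogDeriv E χ z q - rlogDeriv E φ z q := by
    rw [rlogDeriv_mul (hφ z) (hψ z), add_sub_cancel_left]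
  have hcartan : cartanForm B ψ u v w z = B (bracket E D (rlogDeriv E χ z u - rlogDeriv E φ z u)
      (rlogDeriv E χ z v - rlogDeriv E φ z v)) (rlogDeriv E χ z w - rlogDeriv E φ z w) := by
    rw [← hψ_eq, ← hψ_eq, ← hψ_eq, bracket_Ad, hinv, cartanForm]
  rw [hcartan, form_bracket_sub hsymm hinv, cartanForm, cartanForm, hprod, hprod, hprod]
  simp only [← maurerCartan_equation (hφ z), ← maurerCartan_equation (hχ z), map_sub,
    _root_.sub_apply, hsymm (rlogDeriv E φ z _)]
  ring

variable (B) in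
/-- Any two values of the logarithmic derivative of `φ` are orthogonal, as is the case for maps to a
subgroup with isotropic Lie algebra. -/
def IsIsotropicMap (φ : M → D) : Prop :=
  ∀ z z' u u', B (rlogDeriv E φ z u) (rlogDeriv E φ z' u') = 0

theorem IsIsotropicMap.cartanForm_eq_zero {φ : M → D} (h : IsIsotropicMap B φ)
    (hφ : ∀ z, SmoothAt E φ z) (u v w z : M) : cartanForm B φ u v w z = 0 := by
  have horth (p q : M) :
      B (fderiv ℝ (fun x => rlogDeriv E φ x q) z p) (rlogDeriv E φ z w) = 0 := by
    have hdiff : DifferentiableAt ℝ (fun x => rlogDeriv E φ x q) z :=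
      ((contDiffAt_rlogDeriv (hφ z)).differentiableAt (by simp)).clm_apply
        (differentiableAt_const q)
    have hprod := fderiv_form (B := B) hdiff (differentiableAt_const (rlogDeriv E φ z w)) p
    simpa [h _ z q w] using hprod.symm
  rw [cartanForm, ← maurerCartan_equation (hφ z), map_sub, _root_.sub_apply, horth, horth, sub_zero]

theorem pwForm_eq_of_isIsotropicMap {φ ψ : M → D} {z : M} (hsymm : ∀ x y, B x y = B y x)
    (hinv : ∀ (d : D) (x y : Lie E D), B (Ad E d x) (Ad E d y) = B x y)
    (hφ : SmoothAt E φ z) (hψ : SmoothAt E ψ z) (iφ : IsIsotropicMap B φ)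
    (iψ : IsIsotropicMap B ψ) (u v : M) :
    pwForm B φ ψ u v z = 2 * B (rlogDeriv E φ z u) (rlogDeriv E (fun w => φ w * ψ w) z v) -
      B (rlogDeriv E (fun w => φ w * ψ w) z u) (rlogDeriv E (fun w => φ w * ψ w) z v) := by
  have hAd : B (Ad E (φ z) (rlogDeriv E ψ z u)) (Ad E (φ z) (rlogDeriv E ψ z v)) = 0 := by
    rw [hinv, iψ]
  simp only [pwForm, rlogDeriv_mul hφ hψ, map_add, _root_.add_apply, iφ z z, hAd,
    hsymm (Ad E (φ z) (rlogDeriv E ψ z u))]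
  ring

end InvariantForm

end Calculus

/-! ### Smoothness of the factorization -/

section Factor

attribute [local instance] lieNormedAddCommGroup lieNormedSpace lieTop

variable {E EG EH : Type*}
  [NormedAddCommGroup E] [NormedSpace ℝ E] [NormedAddCommGroup EG] [NormedSpace ℝ EG]
  [NormedAddCommGroup EH] [NormedSpace ℝ EH]
  {D G H : Type*}
  [TopologicalSpace D] [ChartedSpace E D] [Group D]
  [TopologicalSpace G] [ChartedSpace EG G] [Group G]
  [TopologicalSpace H] [ChartedSpace EH H] [Group H]
  {M : Type*} [NormedAddCommGroup M] [NormedSpace ℝ M]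

theorem SmoothAt.hom {i : G →* D} (hi : ContMDiff 𝓘(ℝ, EG) 𝓘(ℝ, E) ∞ i) {φ : M → G} {z : M}
    (hφ : SmoothAt EG φ z) : SmoothAt E (fun w => i (φ w)) z :=
  hi.contMDiffAt.comp z hφ

theorem finiteDimensional_of_isLieSubgroup [FiniteDimensional ℝ E] {i : G →* D}
    (hi : IsLieSubgroup E EG i) : FiniteDimensional ℝ EG :=
  have : FiniteDimensional ℝ (Lie E D) := inferInstanceAs (FiniteDimensional ℝ E)
  FiniteDimensional.of_injective (dHom E EG i) hi.immersive

/-- Multiplication of two Lie subgroups, read in the charts of the subgroups at `1`; it parametrizes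
a neighbourhood of `1` when their Lie algebras are complementary. -/
def chartMul (iG : G →* D) (iH : H →* D) (p : Lie EG G × Lie EH H) : D :=
  iG ((unitChart EG G).symm p.1) * iH ((unitChart EH H).symm p.2)

omit [TopologicalSpace D] in
theorem chartMul_unitChart_one (iG : G →* D) (iH : H →* D) :
    chartMul iG iH (unitChart EG G 1, unitChart EH H 1) = 1 := by
  simp only [chartMul, unitChart_symm_one, map_one, mul_one]

theorem bijective_coprod_of_isCompl {V W X : Type*} [AddCommGroup V] [Module ℝ V] [AddCommGroup W]
    [Module ℝ W] [AddCommGroup X] [Module ℝ X] {f : V →ₗ[ℝ] X} {g : W →ₗ[ℝ] X}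
    (hf : Function.Injective f) (hg : Function.Injective g)
    (h : IsCompl (LinearMap.range f) (LinearMap.range g)) :
    Function.Bijective (f.coprod g) := by
  refine ⟨?_, ?_⟩
  · rw [← LinearMap.ker_eq_bot, LinearMap.ker_coprod_of_disjoint_range f g h.disjoint,
      LinearMap.ker_eq_bot.2 hf, LinearMap.ker_eq_bot.2 hg, Submodule.prod_bot]
  · rw [← LinearMap.range_eq_top, LinearMap.range_coprod, h.sup_eq_top]

namespace PerfectDouble

variable (P : PerfectDouble E EG EH D G H)

theorem factor_mul_inH (l : D) (h : H) : P.factor (l * P.inH h) = P.factor l := by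
  obtain ⟨h', e⟩ := P.factor_spec l
  exact P.factor_eq (h := h' * h) (by rw [map_mul, ← mul_assoc, ← e])

theorem factor_inG_mul (g : G) (l : D) : P.factor (P.inG g * l) = g * P.factor l := by
  obtain ⟨h', e⟩ := P.factor_spec l
  exact P.factor_eq (h := h') (by rw [map_mul, mul_assoc, ← e])

/-- The factor `ĥ ∈ Ĝ` of `l = g ĥ`, read off from `l⁻¹ = ĥ⁻¹ g⁻¹` so that its smoothness follows
from that of `factor` by exchanging `G` and `Ĝ`. -/
def cofactor (l : D) : H := (P.swap.factor l⁻¹)⁻¹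

theorem factor_mul_cofactor (l : D) : P.inG (P.factor l) * P.inH (P.cofactor l) = l := by
  obtain ⟨h, e⟩ := P.factor_spec l
  have hinv : l⁻¹ = P.inH h⁻¹ * P.inG (P.factor l)⁻¹ := by
    rw [map_inv, map_inv, ← mul_inv_rev, ← e]
  rw [cofactor, P.swap.factor_eq hinv, inv_inv, ← e]

end PerfectDouble

variable [LieGroup 𝓘(ℝ, E) ∞ D]

theorem contMDiffAt_unitChart :
    ContMDiffAt 𝓘(ℝ, E) 𝓘(ℝ, Lie E D) ∞ (unitChart E D) 1 :=
  have := isManifold_of_lieGroup (E := E) (D := D)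
  contMDiffAt_extChartAt

theorem exists_local_rightInverse [CompleteSpace E] [CompleteSpace M] {ψ : M → D} {p : M}
    (hψ : SmoothAt E ψ p) (h1 : ψ p = 1) (hbij : Function.Bijective (rlogDeriv E ψ p)) :
    ∃ s : D → M, s 1 = p ∧ ContMDiffAt 𝓘(ℝ, E) 𝓘(ℝ, M) ∞ s 1 ∧ ∀ᶠ l in 𝓝 1, ψ (s l) = l := by
  have : CompleteSpace (Lie E D) := inferInstanceAs (CompleteSpace E)
  set κ : M → Lie E D := fun w => unitChart E D (ψ w)
  have hκ : ContDiffAt ℝ ∞ κ p := hψ.contDiffAt_unitChart h1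
  have hκp : κ p = unitChart E D 1 := congrArg (unitChart E D) h1
  let L : M ≃L[ℝ] Lie E D := .ofBijective (rlogDeriv E ψ p)
    (LinearMap.ker_eq_bot.2 hbij.1) (LinearMap.range_eq_top.2 hbij.2)
  have hderiv : HasFDerivAt κ (L : M →L[ℝ] Lie E D) p := by
    rw [ContinuousLinearEquiv.coe_ofBijective,
      rlogDeriv_eq_fderiv (hψ.mdifferentiableAt (by simp)), h1]
    simpa only [inv_one, mul_one] using (hκ.differentiableAt (by simp)).hasFDerivAt
  set σ : Lie E D → M := hκ.localInverse hderiv (by simp)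
  have hσ : ContDiffAt ℝ ∞ σ (unitChart E D 1) := hκp ▸ hκ.to_localInverse hderiv (by simp)
  have hσp : σ (unitChart E D 1) = p := hκp ▸ hκ.localInverse_apply_image hderiv (by simp)
  have hright : ∀ᶠ y in 𝓝 (unitChart E D 1), κ (σ y) = y :=
    hκp ▸ (hκ.hasStrictFDerivAt' hderiv (by simp)).eventually_right_inverse
  have hsource : ∀ᶠ l in 𝓝 (1 : D), l ∈ (unitChart E D).source :=
    (unitChart E D).open_source.mem_nhds (mem_chart_source E 1)
  have hs : ContMDiffAt 𝓘(ℝ, E) 𝓘(ℝ, M) ∞ (fun l => σ (unitChart E D l)) 1 :=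
    ContMDiffAt.comp (I' := 𝓘(ℝ, Lie E D)) (1 : D) (g := σ) hσ.contMDiffAt contMDiffAt_unitChart
  have hψs : Tendsto (fun l => ψ (σ (unitChart E D l))) (𝓝 1) (𝓝 1) := by
    have hψ' : Tendsto ψ (𝓝 (σ (unitChart E D 1))) (𝓝 1) := by
      rw [hσp]; exact h1 ▸ hψ.continuousAt
    exact hψ'.comp hs.continuousAt
  refine ⟨fun l => σ (unitChart E D l), hσp, hs, ?_⟩
  filter_upwards [hsource, hψs.eventually hsource,
    contMDiffAt_unitChart.continuousAt.eventually hright] with l hl hψl hκl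
  exact (unitChart E D).injOn hψl hl hκl

variable [LieGroup 𝓘(ℝ, EG) ∞ G] [LieGroup 𝓘(ℝ, EH) ∞ H]

theorem smoothAt_chartMul {iG : G →* D} {iH : H →* D}
    (hG : ContMDiff 𝓘(ℝ, EG) 𝓘(ℝ, E) ∞ iG) (hH : ContMDiff 𝓘(ℝ, EH) 𝓘(ℝ, E) ∞ iH) :
    SmoothAt E (chartMul iG iH) (unitChart EG G 1, unitChart EH H 1) :=
  ((eventually_smoothAt_unitChart_symm.self_of_nhds.comp_contDiffAt (j := Prod.fst)
    (z := (unitChart EG G 1, unitChart EH H 1)) contDiffAt_fst).hom hG).mul_smoothAt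
  ((eventually_smoothAt_unitChart_symm.self_of_nhds.comp_contDiffAt (j := Prod.snd)
    (z := (unitChart EG G 1, unitChart EH H 1)) contDiffAt_snd).hom hH)

theorem rlogDeriv_chartMul {iG : G →* D} {iH : H →* D}
    (hG : ContMDiff 𝓘(ℝ, EG) 𝓘(ℝ, E) ∞ iG) (hH : ContMDiff 𝓘(ℝ, EH) 𝓘(ℝ, E) ∞ iH)
    (p : Lie EG G × Lie EH H) :
    rlogDeriv E (chartMul iG iH) (unitChart EG G 1, unitChart EH H 1) p =
      (dHom E EG iG).coprod (dHom E EH iH) p := by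
  have hsG := (eventually_smoothAt_unitChart_symm (E := EG) (D := G)).self_of_nhds
  have hsH := (eventually_smoothAt_unitChart_symm (E := EH) (D := H)).self_of_nhds
  have hsG' := hsG.comp_contDiffAt (j := Prod.fst)
    (z := (unitChart EG G 1, unitChart EH H 1)) contDiffAt_fst
  have hsH' := hsH.comp_contDiffAt (j := Prod.snd)
    (z := (unitChart EG G 1, unitChart EH H 1)) contDiffAt_snd
  unfold chartMul
  rw [rlogDeriv_mul (hsG'.hom hG) (hsH'.hom hH), rlogDeriv_hom hG hsG', rlogDeriv_hom hH hsH',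
    rlogDeriv_comp (j := Prod.fst) hsG differentiableAt_fst,
    rlogDeriv_comp (j := Prod.snd) hsH differentiableAt_snd, fderiv_fst, fderiv_snd]
  simp only [unitChart_symm_one, map_one, Ad_one, ContinuousLinearMap.comp_apply,
    ContinuousLinearMap.coe_fst', ContinuousLinearMap.coe_snd', rlogDeriv_unitChart_symm,
    LinearMap.coprod_apply]

theorem exists_local_factorization [FiniteDimensional ℝ E] {iG : G →* D} {iH : H →* D}
    (hG : IsLieSubgroup E EG iG) (hH : IsLieSubgroup E EH iH)
    (hcompl : IsCompl (lieAlgebraOf E EG iG) (lieAlgebraOf E EH iH)) :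
    ∃ a : D → G, ∃ b : D → H,
      ContMDiffAt 𝓘(ℝ, E) 𝓘(ℝ, EG) ∞ a 1 ∧ ∀ᶠ l in 𝓝 (1 : D), iG (a l) * iH (b l) = l := by
  have := finiteDimensional_of_isLieSubgroup hG
  have := finiteDimensional_of_isLieSubgroup hH
  have : CompleteSpace E := FiniteDimensional.complete ℝ E
  have : CompleteSpace (Lie EG G) := FiniteDimensional.complete ℝ EG
  have : CompleteSpace (Lie EH H) := FiniteDimensional.complete ℝ EH
  have hderiv : ⇑(rlogDeriv E (chartMul iG iH) (unitChart EG G 1, unitChart EH H 1)) =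
      (dHom E EG iG).coprod (dHom E EH iH) := funext (rlogDeriv_chartMul hG.smooth hH.smooth)
  obtain ⟨s, hs1, hs, hright⟩ := exists_local_rightInverse (smoothAt_chartMul hG.smooth hH.smooth)
    (chartMul_unitChart_one iG iH)
    (hderiv ▸ bijective_coprod_of_isCompl hG.immersive hH.immersive hcompl)
  refine ⟨fun l => (unitChart EG G).symm (s l).1, fun l => (unitChart EH H).symm (s l).2, ?_,
    hright⟩
  have hfst : SmoothAt EG (fun p : Lie EG G × Lie EH H => (unitChart EG G).symm p.1) (s 1) := by
    rw [hs1]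
    exact eventually_smoothAt_unitChart_symm.self_of_nhds.comp_contDiffAt (j := Prod.fst)
      (z := (unitChart EG G 1, unitChart EH H 1)) contDiffAt_fst
  exact hfst.comp 1 hs

namespace PerfectDouble

variable (P : PerfectDouble E EG EH D G H)

theorem contMDiff_factor [FiniteDimensional ℝ E] : ContMDiff 𝓘(ℝ, E) 𝓘(ℝ, EG) ∞ P.factor := by
  obtain ⟨a, b, ha, hab⟩ := exists_local_factorization P.isLieSubgroup_inG P.isLieSubgroup_inH
    P.isCompl
  have hone : ContMDiffAt 𝓘(ℝ, E) 𝓘(ℝ, EG) ∞ P.factor 1 :=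
    ha.congr_of_eventuallyEq (hab.mono fun l hl => P.factor_eq hl.symm)
  intro l₀
  obtain ⟨h₀, e⟩ := P.factor_spec l₀
  have htranslate : P.factor = fun l => P.factor l₀ *
      P.factor ((P.inG (P.factor l₀))⁻¹ * l * (P.inH h₀)⁻¹) := by
    funext l
    rw [← map_inv, ← map_inv, P.factor_mul_inH, P.factor_inG_mul, mul_inv_cancel_left]
  have hmap : ContMDiffAt 𝓘(ℝ, E) 𝓘(ℝ, E) ∞
      (fun l : D => (P.inG (P.factor l₀))⁻¹ * l * (P.inH h₀)⁻¹) l₀ :=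
    ((contMDiff_const.mul contMDiff_id).mul contMDiff_const).contMDiffAt
  have hl₀ : (P.inG (P.factor l₀))⁻¹ * l₀ * (P.inH h₀)⁻¹ = 1 := by
    rw [mul_inv_eq_one, inv_mul_eq_iff_eq_mul, ← e]
  rw [htranslate]
  exact contMDiffAt_const.mul (ContMDiffAt.comp l₀ (g := P.factor) (hl₀ ▸ hone) hmap)

theorem contMDiff_cofactor [FiniteDimensional ℝ E] :
    ContMDiff 𝓘(ℝ, E) 𝓘(ℝ, EH) ∞ P.cofactor :=
  (P.swap.contMDiff_factor.comp (contMDiff_inv 𝓘(ℝ, E) ∞)).inv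

end PerfectDouble

end Factor

/-! ### Stokes' theorem along a homotopy -/

section Stokes

variable {V : Type*} [NormedAddCommGroup V] [NormedSpace ℝ V] {q : ℝ × V → ℝ}

theorem fderiv_comp_prodMk_right (hq : Differentiable ℝ q) (t : ℝ) (z w : V) :
    fderiv ℝ (fun z => q (t, z)) z w = fderiv ℝ q (t, z) (0, w) :=
  DFunLike.congr_fun
    ((hq (t, z)).hasFDerivAt.comp (f := fun z => (t, z)) z (hasFDerivAt_prodMk_right t z)).fderiv w

theorem sub_eq_setIntegral_fderiv (hq : ContDiff ℝ 1 q) (z : V) :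
    q (1, z) - q (0, z) = ∫ t in Set.Ioc (0 : ℝ) 1, fderiv ℝ q (t, z) (1, 0) := by
  have hderiv (t : ℝ) : HasDerivAt (fun t => q (t, z)) (fderiv ℝ q (t, z) (1, 0)) t :=
    ((hq.differentiable one_ne_zero (t, z)).hasFDerivAt.comp (f := fun t => (t, z)) t
      (hasFDerivAt_prodMk_left t z)).hasDerivAt
  have hcont : Continuous fun t => fderiv ℝ q (t, z) (1, 0) :=
    ((hq.continuous_fderiv one_ne_zero).comp (by fun_prop)).clm_apply continuous_const
  rw [← intervalIntegral.integral_of_le zero_le_one,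
    intervalIntegral.integral_eq_sub_of_hasDerivAt (fun t _ => hderiv t)
      (hcont.intervalIntegrable 0 1)]

variable [FiniteDimensional ℝ V] [MeasurableSpace V] [BorelSpace V] {μ : Measure V}

section Haar

variable [μ.IsAddHaarMeasure]

theorem integral_fderiv_eq_zero {p : V → ℝ} (hp : ContDiff ℝ 1 p) (hc : HasCompactSupport p)
    (u : V) : ∫ z, fderiv ℝ p z u ∂μ = 0 := by
  have hint : Integrable p μ := hp.continuous.integrable_of_hasCompactSupport hc
  have hint' : Integrable (fun z => fderiv ℝ p z u) μ :=
    ((hp.continuous_fderiv one_ne_zero).clm_apply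
      continuous_const).integrable_of_hasCompactSupport (hc.fderiv_apply ℝ u)
  have h := integral_mul_fderiv_eq_neg_fderiv_mul_of_integrable (μ := μ)
    (f := fun _ => (1 : ℝ)) (g := p) (v := u) (by simp) (by simpa using hint')
    (by simpa using hint) (fun x _ => by fun_prop) (fun x _ => hp.differentiable one_ne_zero x)
  simpa using h

theorem setIntegral_fderiv_eq_zero {K : Set V} (hK : IsCompact K) {p : V → ℝ}
    (hp : ContDiff ℝ 1 p) (hpK : ∀ z ∉ K, p z = 0) (u : V) :
    ∫ z in K, fderiv ℝ p z u ∂μ = 0 := by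
  rw [setIntegral_eq_integral_of_forall_compl_eq_zero fun z hz => ?_]
  · exact integral_fderiv_eq_zero hp (HasCompactSupport.intro hK hpK) u
  · have hloc : p =ᶠ[𝓝 z] fun _ => 0 :=
      mem_of_superset (hK.isClosed.isOpen_compl.mem_nhds hz) hpK
    simp [hloc.fderiv_eq]

theorem setIntegral_fderiv_slice_eq_zero {K : Set V} (hK : IsCompact K) (hq : ContDiff ℝ 1 q)
    {t : ℝ} (hqK : ∀ z ∉ K, q (t, z) = 0) (u : V) :
    ∫ z in K, fderiv ℝ q (t, z) (0, u) ∂μ = 0 := by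
  simp only [← fderiv_comp_prodMk_right (hq.differentiable one_ne_zero)]
  exact setIntegral_fderiv_eq_zero hK (hq.comp (contDiff_const.prodMk contDiff_id)) hqK u

end Haar

omit [FiniteDimensional ℝ V] in
theorem setIntegral_sub_eq_integral_setIntegral_fderiv [IsFiniteMeasureOnCompacts μ] [SFinite μ]
    {K : Set V} (hK : IsCompact K) (hq : ContDiff ℝ 1 q) :
    ∫ z in K, (q (1, z) - q (0, z)) ∂μ =
      ∫ t in Set.Ioc (0 : ℝ) 1, ∫ z in K, fderiv ℝ q (t, z) (1, 0) ∂μ := by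
  simp only [sub_eq_setIntegral_fderiv hq]
  refine integral_integral_swap ?_
  rw [Measure.prod_restrict]
  have hcont : Continuous fun p : V × ℝ => fderiv ℝ q (p.2, p.1) (1, 0) :=
    ((hq.continuous_fderiv one_ne_zero).comp (by fun_prop)).clm_apply continuous_const
  exact (hcont.continuousOn.integrableOn_compact (hK.prod isCompact_Icc)).mono_set
    (Set.prod_mono le_rfl Set.Ioc_subset_Icc_self)

theorem setIntegral_sub_eq_zero_of_closed [μ.IsAddHaarMeasure] {Ω : ℝ × V → ℝ × V → ℝ × V → ℝ}
    (hΩ : ∀ u v, ContDiff ℝ 1 (Ω u v))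
    (hclosed : ∀ u v w x,
      fderiv ℝ (Ω v w) x u + fderiv ℝ (Ω w u) x v + fderiv ℝ (Ω u v) x w = 0)
    {K : Set V} (hK : IsCompact K) (hΩK : ∀ u v t, ∀ z ∉ K, Ω u v (t, z) = 0) (u v : V) :
    ∫ z in K, (Ω (0, u) (0, v) (1, z) - Ω (0, u) (0, v) (0, z)) ∂μ = 0 := by
  rw [setIntegral_sub_eq_integral_setIntegral_fderiv hK (hΩ _ _)]
  refine integral_eq_zero_of_ae (Eventually.of_forall fun t => ?_)
  have hint (a b w) : IntegrableOn (fun z => fderiv ℝ (Ω a b) (t, z) w) K μ :=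
    Continuous.continuousOn (((hΩ a b).continuous_fderiv one_ne_zero).comp
      (by fun_prop) |>.clm_apply continuous_const) |>.integrableOn_compact hK
  have hsplit (z : V) : fderiv ℝ (Ω (0, u) (0, v)) (t, z) (1, 0) =
      -(fderiv ℝ (Ω (0, v) (1, 0)) (t, z) (0, u) + fderiv ℝ (Ω (1, 0) (0, u)) (t, z) (0, v)) := by
    linarith [hclosed (1, 0) (0, u) (0, v) (t, z)]
  simp only [hsplit, Pi.zero_apply]
  rw [integral_neg, integral_add (hint _ _ _) (hint _ _ _),
    setIntegral_fderiv_slice_eq_zero hK (hΩ _ _) (hΩK _ _ t),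
    setIntegral_fderiv_slice_eq_zero hK (hΩ _ _) (hΩK _ _ t), add_zero, neg_zero]

end Stokes

/-! ### Invariance of a model up to a closed form -/

section DressingForm

attribute [local instance] lieNormedAddCommGroup lieNormedSpace lieTop

variable {E : Type*} [NormedAddCommGroup E] [NormedSpace ℝ E]
  {D : Type*} [TopologicalSpace D] [ChartedSpace E D] [Group D]
  {M M' : Type*} [NormedAddCommGroup M] [NormedSpace ℝ M] [NormedAddCommGroup M']
  [NormedSpace ℝ M'] {B : Lie E D →L[ℝ] Lie E D →L[ℝ] ℝ} {φ ψ γ γ' η : M → D}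

theorem pwForm_eq_zero_of_left {z : M} (h : φ =ᶠ[𝓝 z] fun _ => 1) (u v : M) :
    pwForm B φ ψ u v z = 0 := by
  simp [pwForm, rlogDeriv_congr h, rlogDeriv_const]

theorem pwForm_eq_zero_of_right {z : M} (h : ψ =ᶠ[𝓝 z] fun _ => 1) (u v : M) :
    pwForm B φ ψ u v z = 0 := by
  simp [pwForm, rlogDeriv_congr h, rlogDeriv_const]

variable (B) in
/-- The difference of the Polyakov–Wiegmann `2`-forms of the two factorizations of a map
`φ γ = γ' η`. -/
def dressingForm (φ γ γ' η : M → D) (u v z : M) : ℝ :=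
  pwForm B φ γ u v z - pwForm B γ' η u v z

variable [LieGroup 𝓘(ℝ, E) ∞ D]

theorem pwForm_comp {j : M' → M} {z : M'} (hφ : SmoothAt E φ (j z)) (hψ : SmoothAt E ψ (j z))
    (hj : DifferentiableAt ℝ j z) (u v : M') :
    pwForm B (fun w => φ (j w)) (fun w => ψ (j w)) u v z =
      pwForm B φ ψ (fderiv ℝ j z u) (fderiv ℝ j z v) (j z) := by
  simp only [pwForm, rlogDeriv_comp hφ hj, rlogDeriv_comp hψ hj,
    ContinuousLinearMap.comp_apply]

variable (hsymm : ∀ x y, B x y = B y x)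
include hsymm

theorem contDiff_pwForm (hφ : ∀ z, SmoothAt E φ z) (hψ : ∀ z, SmoothAt E ψ z) (u v : M) :
    ContDiff ℝ ∞ (pwForm B φ ψ u v) := by
  have hsmooth {θ : M → D} (hθ : ∀ z, SmoothAt E θ z) (q : M) :
      ContDiff ℝ ∞ fun z => rlogDeriv E θ z q :=
    (contDiff_iff_contDiffAt.2 fun z => contDiffAt_rlogDeriv (hθ z)).clm_apply contDiff_const
  have hχ (z : M) : SmoothAt E (fun w => φ w * ψ w) z := (hφ z).mul_smoothAt (hψ z)
  rw [funext fun z => pwForm_eq_mul hsymm (hφ z) (hψ z) u v]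
  exact ((contDiff_const.clm_apply (hsmooth hφ u)).clm_apply (hsmooth hχ v)).sub
    ((contDiff_const.clm_apply (hsmooth hφ v)).clm_apply (hsmooth hχ u))

variable (B) in
/-- Two factorizations `φ γ = γ' η` of a map into smooth isotropic factors, such as
`f g = (f ▷ g) ĥ`. -/
structure IsIsotropicSquare (φ γ γ' η : M → D) : Prop where
  smoothAt₁ : ∀ z, SmoothAt E φ z
  smoothAt₂ : ∀ z, SmoothAt E γ z
  smoothAt₃ : ∀ z, SmoothAt E γ' z
  smoothAt₄ : ∀ z, SmoothAt E η z
  isotropic₁ : IsIsotropicMap B φ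
  isotropic₂ : IsIsotropicMap B γ
  isotropic₃ : IsIsotropicMap B γ'
  isotropic₄ : IsIsotropicMap B η
  mul_eq : ∀ z, φ z * γ z = γ' z * η z

namespace IsIsotropicSquare

variable (h : IsIsotropicSquare B φ γ γ' η)
include h

theorem contDiff_dressingForm (u v : M) : ContDiff ℝ ∞ (dressingForm B φ γ γ' η u v) :=
  (contDiff_pwForm hsymm h.smoothAt₁ h.smoothAt₂ u v).sub
    (contDiff_pwForm hsymm h.smoothAt₃ h.smoothAt₄ u v)

variable (hinv : ∀ (d : D) (x y : Lie E D), B (Ad E d x) (Ad E d y) = B x y)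
include hinv

/- Both exterior derivatives are minus the Cartan form of `φ γ`, the Cartan forms of the four
factors being zero. -/
theorem cyclic_fderiv_dressingForm (u v w z : M) :
    fderiv ℝ (dressingForm B φ γ γ' η v w) z u + fderiv ℝ (dressingForm B φ γ γ' η w u) z v +
      fderiv ℝ (dressingForm B φ γ γ' η u v) z w = 0 := by
  have hfderiv (p q r : M) : fderiv ℝ (dressingForm B φ γ γ' η q r) z p =
      fderiv ℝ (pwForm B φ γ q r) z p - fderiv ℝ (pwForm B γ' η q r) z p := by
    have hdiff := (contDiff_pwForm hsymm h.smoothAt₁ h.smoothAt₂ q r).differentiable (by simp) z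
    have hdiff' := (contDiff_pwForm hsymm h.smoothAt₃ h.smoothAt₄ q r).differentiable (by simp) z
    exact DFunLike.congr_fun (fderiv_fun_sub hdiff hdiff') p
  have hleft := cyclic_fderiv_pwForm hsymm hinv h.smoothAt₁ h.smoothAt₂ u v w z
  have hright := cyclic_fderiv_pwForm hsymm hinv h.smoothAt₃ h.smoothAt₄ u v w z
  rw [h.isotropic₁.cartanForm_eq_zero h.smoothAt₁, h.isotropic₂.cartanForm_eq_zero h.smoothAt₂]
    at hleft
  rw [h.isotropic₃.cartanForm_eq_zero h.smoothAt₃, h.isotropic₄.cartanForm_eq_zero h.smoothAt₄,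
    ← funext h.mul_eq] at hright
  rw [hfderiv, hfderiv, hfderiv]
  linarith

theorem dressingForm_eq (u v z : M) : dressingForm B φ γ γ' η u v z =
    2 * B (rlogDeriv E φ z u - rlogDeriv E γ' z u) (rlogDeriv E (fun w => φ w * γ w) z v) := by
  rw [dressingForm, pwForm_eq_of_isIsotropicMap hsymm hinv (h.smoothAt₁ z) (h.smoothAt₂ z)
      h.isotropic₁ h.isotropic₂,
    pwForm_eq_of_isIsotropicMap hsymm hinv (h.smoothAt₃ z) (h.smoothAt₄ z)
      h.isotropic₃ h.isotropic₄, ← funext h.mul_eq, map_sub, _root_.sub_apply]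
  ring

end IsIsotropicSquare

end DressingForm

section Models

variable {E EG EH EF : Type*}
  [NormedAddCommGroup E] [NormedSpace ℝ E] [NormedAddCommGroup EG] [NormedSpace ℝ EG]
  [NormedAddCommGroup EH] [NormedSpace ℝ EH] [NormedAddCommGroup EF] [NormedSpace ℝ EF]
  {D G H F : Type*}
  [TopologicalSpace D] [ChartedSpace E D] [Group D]
  [TopologicalSpace G] [ChartedSpace EG G] [Group G]
  [TopologicalSpace H] [ChartedSpace EH H] [Group H]
  [TopologicalSpace F] [ChartedSpace EF F] [Group F]

namespace PerfectDouble

variable (P : PerfectDouble E EG EH D G H)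

theorem dress_mul_cofactor (d : D) (g : G) :
    P.inG (P.dress d g) * P.inH (P.cofactor (d * P.inG g)) = d * P.inG g :=
  P.factor_mul_cofactor _

theorem cofactor_inG (g : G) : P.cofactor (P.inG g) = 1 := by
  rw [cofactor, P.swap.factor_eq (g := 1) (h := g⁻¹) (by simp), inv_one]

/-- The subspace `Ad_g 𝒢̂`, along which the current of a field is projected. -/
def twist (g : G) : Submodule ℝ (Lie E D) := P.dualAlg.map (Ad E (P.inG g))

variable (EF) in
/-- A subspace `S` of the Lie algebra of `D` from which an `F`-gauge invariant model is built: it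
is `Ad_F`-invariant, contains the Lie algebra of `F`, and is orthogonal to it. -/
structure IsCosetSpace (i : F →* D) (S : Submodule ℝ (Lie E D)) : Prop where
  Ad_mem : ∀ (f : F), ∀ x ∈ S, Ad E (i f) x ∈ S
  le : lieAlgebraOf E EF i ≤ S
  orthogonal : ∀ v ∈ lieAlgebraOf E EF i, ∀ x ∈ S, P.form v x = 0

/-- The `σ`-model on `G` with density `ℓ` is the one built from the subspace `S`: `ℓ g b a` is
`⟨b | e⟩`, where `e` is the component in `S` of `a` with respect to the decomposition of the Lie
algebra of `D` into `S` and `Ad_g 𝒢̂`. -/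
structure IsModel (S : Submodule ℝ (Lie E D)) (adm : G → Prop) (ℓ : G → P.alg → P.alg → ℝ) :
    Prop where
  adm_iff : ∀ g, adm g ↔ IsCompl S (P.twist g)
  density_eq : ∀ g, adm g → ∀ (b a : P.alg), ∀ e ∈ S, e - (a : Lie E D) ∈ P.twist g →
    ℓ g b a = P.form b e

theorem form_twist {g : G} {x y : Lie E D} (hx : x ∈ P.twist g) (hy : y ∈ P.twist g) :
    P.form x y = 0 := by
  obtain ⟨x, hx, rfl⟩ := hx
  obtain ⟨y, hy, rfl⟩ := hy
  rw [P.form_invariant, P.isotropicH x hx y hy]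

theorem two_mul_form_of_sub_mem_twist {g : G} {a : P.alg} {e : Lie E D}
    (h : e - (a : Lie E D) ∈ P.twist g) : 2 * P.form a e = P.form e e := by
  have htwist := P.form_twist h h
  have halg := P.isotropicG a a.2 a a.2
  have hsymm := P.form_symm e a
  simp only [map_sub, LinearMap.sub_apply] at htwist
  linarith

end PerfectDouble

theorem exists_sub_mem_of_codisjoint {V : Type*} [AddCommGroup V] [Module ℝ V] {S T : Submodule ℝ V}
    (h : Codisjoint S T) (a : V) : ∃ e ∈ S, e - a ∈ T := by
  obtain ⟨e, t, he, ht, rfl⟩ := Submodule.codisjoint_iff_exists_add_eq.1 h a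
  exact ⟨e, he, by rw [sub_add_cancel_left]; exact neg_mem ht⟩

theorem map_eq_of_forall_map_le {K V : Type*} [Group K] [AddCommGroup V] [Module ℝ V]
    {A : K → V →ₗ[ℝ] V} (hA : ∀ k x, A k (A k⁻¹ x) = x) {S : Submodule ℝ V}
    (h : ∀ k, ∀ x ∈ S, A k x ∈ S) (k : K) : S.map (A k) = S :=
  le_antisymm (Submodule.map_le_iff_le_comap.2 (h k)) fun x hx => ⟨_, h k⁻¹ x hx, hA k x⟩

variable [LieGroup 𝓘(ℝ, E) ∞ D] {M : Type*} [NormedAddCommGroup M] [NormedSpace ℝ M]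

variable (E) in
/-- The adjoint action `Ad_d` as an automorphism of the Lie algebra. -/
def AdEquiv (d : D) : Lie E D ≃ₗ[ℝ] Lie E D :=
  .ofLinearMap (Ad E d) (Ad E d⁻¹) (LinearMap.ext (Ad_Ad_inv d)) (LinearMap.ext (Ad_inv_Ad d))

theorem isCompl_map_Ad (d : D) {S T : Submodule ℝ (Lie E D)} :
    IsCompl (S.map (Ad E d)) (T.map (Ad E d)) ↔ IsCompl S T :=
  (Submodule.orderIsoMapComap (AdEquiv E d)).isCompl_iff.symm

namespace PerfectDouble

variable (P : PerfectDouble E EG EH D G H)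

theorem IsCosetSpace.map_Ad {P : PerfectDouble E EG EH D G H} {i : F →* D}
    {S : Submodule ℝ (Lie E D)} (hS : P.IsCosetSpace EF i S) (f : F) :
    S.map (Ad E (i f)) = S :=
  map_eq_of_forall_map_le (A := fun f => Ad E (i f))
    (fun f x => by rw [map_inv, Ad_Ad_inv]) hS.Ad_mem f

end PerfectDouble

section Subgroup

variable {E' S : Type*} [NormedAddCommGroup E'] [NormedSpace ℝ E']
  [TopologicalSpace S] [ChartedSpace E' S] [Group S] [LieGroup 𝓘(ℝ, E') ∞ S] {j : S →* D}
  (hj : ContMDiff 𝓘(ℝ, E') 𝓘(ℝ, E) ∞ j)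
include hj

omit [LieGroup 𝓘(ℝ, E) ∞ D] in
theorem rlogDeriv_hom_mem {φ : M → S} {z : M} (hφ : SmoothAt E' φ z) (u : M) :
    rlogDeriv E (fun w => j (φ w)) z u ∈ lieAlgebraOf E E' j :=
  ⟨_, (rlogDeriv_hom hj hφ u).symm⟩

attribute [local instance] lieNormedAddCommGroup lieNormedSpace lieTop in
theorem Ad_mem_lieAlgebraOf (s : S) {x : Lie E D} (hx : x ∈ lieAlgebraOf E E' j) :
    Ad E (j s) x ∈ lieAlgebraOf E E' j := by
  obtain ⟨y, rfl⟩ := hx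
  have hsmooth := (eventually_smoothAt_unitChart_symm (E := E') (D := S)).self_of_nhds
  have h := rlogDeriv_conj (j s) (hsmooth.hom hj) y
  rw [rlogDeriv_hom hj hsmooth, rlogDeriv_unitChart_symm] at h
  rw [← h]
  simpa only [map_mul, map_inv] using rlogDeriv_hom_mem hj (hsmooth.conj s) y

theorem map_Ad_lieAlgebraOf (s : S) :
    (lieAlgebraOf E E' j).map (Ad E (j s)) = lieAlgebraOf E E' j :=
  map_eq_of_forall_map_le (A := fun s => Ad E (j s)) (fun s x => by rw [map_inv, Ad_Ad_inv])
    (fun s _ hx => Ad_mem_lieAlgebraOf hj s hx) s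

end Subgroup

namespace PerfectDouble

variable (P : PerfectDouble E EG EH D G H)

theorem map_Ad_twist [LieGroup 𝓘(ℝ, EH) ∞ H] (d : D) (g : G) :
    (P.twist g).map (Ad E d) = P.twist (P.dress d g) := by
  have hmul (a b : D) : Ad E (a * b) = Ad E a ∘ₗ Ad E b := LinearMap.ext (Ad_mul a b)
  rw [twist, ← Submodule.map_comp, ← hmul, ← P.dress_mul_cofactor, hmul, Submodule.map_comp,
    map_Ad_lieAlgebraOf P.isLieSubgroup_inH.smooth, twist]

variable {P} in
theorem IsCosetSpace.isCompl_twist_dress_iff [LieGroup 𝓘(ℝ, EH) ∞ H] {i : F →* D}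
    {S : Submodule ℝ (Lie E D)} (hS : P.IsCosetSpace EF i S) (f : F) (g : G) :
    IsCompl S (P.twist (P.dress (i f) g)) ↔ IsCompl S (P.twist g) := by
  rw [← P.map_Ad_twist]
  conv_lhs => rw [← hS.map_Ad f]
  exact isCompl_map_Ad (i f)

end PerfectDouble

end Models

section Continuity

attribute [local instance] lieNormedAddCommGroup lieNormedSpace lieTop

theorem exists_continuousOn_solution {X V W : Type*} [TopologicalSpace X]
    [NormedAddCommGroup V] [NormedSpace ℝ V] [FiniteDimensional ℝ V]
    [NormedAddCommGroup W] [NormedSpace ℝ W] {L : X → V →ₗ[ℝ] W} {a : X → W}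
    (hL : ∀ v, Continuous fun x => L x v) (ha : Continuous a) :
    ∃ s : X → V, (∀ x, Function.Bijective (L x) → L x (s x) = a x) ∧
      ContinuousOn s {x | Function.Bijective (L x)} := by
  let L' (x : X) : V →L[ℝ] W := (L x).toContinuousLinearMap
  have hL' : Continuous L' := continuous_clm_apply.2 hL
  have hinv {x : X} (hx : Function.Bijective (L x)) : (L' x).IsInvertible :=
    ⟨(LinearEquiv.ofBijective (L x) hx).toContinuousLinearEquiv,
      ContinuousLinearMap.ext fun _ => rfl⟩
  have : CompleteSpace V := FiniteDimensional.complete ℝ V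
  refine ⟨fun x => (L' x).inverse (a x), fun x hx => (hinv hx).self_apply_inverse (a x),
    fun x hx => ContinuousAt.continuousWithinAt ?_⟩
  have hcont : ContinuousAt ContinuousLinearMap.inverse (L' x) :=
    ((hinv hx).contDiffAt_map_inverse (n := 0)).continuousAt
  exact (hcont.comp (f := L') hL'.continuousAt).clm_apply ha.continuousAt

variable {E EG EH : Type*}
  [NormedAddCommGroup E] [NormedSpace ℝ E] [NormedAddCommGroup EG] [NormedSpace ℝ EG]
  [NormedAddCommGroup EH] [NormedSpace ℝ EH]
  {D G H : Type*}
  [TopologicalSpace D] [ChartedSpace E D] [Group D]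
  [TopologicalSpace G] [ChartedSpace EG G] [Group G]
  [TopologicalSpace H] [ChartedSpace EH H] [Group H]
  {M : Type*} [NormedAddCommGroup M] [NormedSpace ℝ M]

namespace PerfectDouble

variable (P : PerfectDouble E EG EH D G H)

/-- The form of the double as a continuous bilinear form. -/
def formL [FiniteDimensional ℝ E] : Lie E D →L[ℝ] Lie E D →L[ℝ] ℝ :=
  have : FiniteDimensional ℝ (Lie E D) := inferInstanceAs (FiniteDimensional ℝ E)
  P.form.toContinuousBilinearMap

theorem exists_continuousOn_component [FiniteDimensional ℝ E] [LieGroup 𝓘(ℝ, E) ∞ D]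
    {S : Submodule ℝ (Lie E D)} {g : M → G} (hg : ∀ z, SmoothAt EG g z)
    {a : M → Lie E D} (ha : Continuous a) :
    ∃ e : M → Lie E D, (∀ z,
        IsCompl S (P.twist (g z)) → e z ∈ S ∧ e z - a z ∈ P.twist (g z)) ∧
      ContinuousOn e {z | IsCompl S (P.twist (g z))} := by
  have : FiniteDimensional ℝ (Lie E D) := inferInstanceAs (FiniteDimensional ℝ E)
  let T (z : M) : P.dualAlg →ₗ[ℝ] Lie E D := Ad E (P.inG (g z)) ∘ₗ P.dualAlg.subtype
  let L (z : M) : S × P.dualAlg →ₗ[ℝ] Lie E D := S.subtype.coprod (T z)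
  have hrange (z : M) : LinearMap.range (T z) = P.twist (g z) := by
    rw [LinearMap.range_comp, Submodule.range_subtype, twist]
  have hbij {z : M} (hz : IsCompl S (P.twist (g z))) : Function.Bijective (L z) :=
    bijective_coprod_of_isCompl S.subtype_injective
      ((AdEquiv E (P.inG (g z))).injective.comp P.dualAlg.subtype_injective)
      (by rwa [Submodule.range_subtype, hrange])
  have hL (v : S × P.dualAlg) : Continuous fun z => L z v :=
    continuous_const.add (continuous_iff_continuousAt.2 fun z => (contDiffAt_Ad
      (.of_forall fun w => (hg w).hom P.isLieSubgroup_inG.smooth) (v.2 : Lie E D)).continuousAt)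
  obtain ⟨s, hs, hcont⟩ := exists_continuousOn_solution hL ha
  refine ⟨fun z => (s z).1, fun z hz => ⟨(s z).1.2, ?_⟩,
    (continuous_subtype_val.comp continuous_fst).comp_continuousOn
      (hcont.mono fun z hz => hbij hz)⟩
  rw [← hrange, ← hs z (hbij hz), LinearMap.coprod_apply, Submodule.subtype_apply,
    sub_add_cancel_left]
  exact neg_mem (LinearMap.mem_range_self _ _)

theorem current_eq [LieGroup 𝓘(ℝ, EG) ∞ G] {g : Worldsheet → G} (hg : IsField EG g)
    (z u : Worldsheet) :
    (P.current g z u : Lie E D) = rlogDeriv E (fun w => P.inG (g w)) z u :=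
  (rlogDeriv_hom P.isLieSubgroup_inG.smooth (hg z) u).symm

theorem continuousOn_lagrangian [FiniteDimensional ℝ E] [LieGroup 𝓘(ℝ, E) ∞ D]
    [LieGroup 𝓘(ℝ, EG) ∞ G] {S : Submodule ℝ (Lie E D)} {adm : G → Prop}
    {ℓ : G → P.alg → P.alg → ℝ} (hm : P.IsModel S adm ℓ) {g : Worldsheet → G}
    (hg : IsField EG g) : ContinuousOn (P.lagrangian ℓ g) {z | adm (g z)} := by
  have hcurrent (u : Worldsheet) : Continuous fun z => (P.current g z u : Lie E D) := by
    simp only [P.current_eq hg]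
    exact continuous_iff_continuousAt.2 fun z =>
      (contDiffAt_rlogDeriv (SmoothAt.hom P.isLieSubgroup_inG.smooth (hg z))).continuousAt.clm_apply
        continuousAt_const
  obtain ⟨e, he, hcont⟩ := P.exists_continuousOn_component (S := S) hg (hcurrent dirPlus)
  simp only [← hm.adm_iff] at he hcont
  refine ContinuousOn.congr (f := fun z => P.formL (P.current g z dirMinus) (e z)) ?_
    fun z hz => hm.density_eq _ hz _ _ _ (he z hz).1 (he z hz).2
  exact (continuousOn_const.clm_apply (hcurrent dirMinus).continuousOn).clm_apply hcont

end PerfectDouble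

end Continuity

section Dressing

attribute [local instance] lieNormedAddCommGroup lieNormedSpace lieTop

variable {E EG EH EF : Type*}
  [NormedAddCommGroup E] [NormedSpace ℝ E] [NormedAddCommGroup EG] [NormedSpace ℝ EG]
  [NormedAddCommGroup EH] [NormedSpace ℝ EH] [NormedAddCommGroup EF] [NormedSpace ℝ EF]
  {D G H F : Type*}
  [TopologicalSpace D] [ChartedSpace E D] [Group D]
  [TopologicalSpace G] [ChartedSpace EG G] [Group G]
  [TopologicalSpace H] [ChartedSpace EH H] [Group H]
  [TopologicalSpace F] [ChartedSpace EF F] [Group F]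
  {M M' : Type*} [NormedAddCommGroup M] [NormedSpace ℝ M] [NormedAddCommGroup M']
  [NormedSpace ℝ M'] [FiniteDimensional ℝ E]

namespace PerfectDouble

variable (P : PerfectDouble E EG EH D G H)

/-- The `2`-form of the factorization `φ g = (φ ▷ g) ĥ` defined by the dressing of a `G`-valued
map `g` by a `D`-valued map `φ`. -/
def gaugeForm (φ : M → D) (g : M → G) : M → M → M → ℝ :=
  dressingForm P.formL φ (fun z => P.inG (g z)) (fun z => P.inG (P.dress (φ z) (g z)))
    fun z => P.inH (P.cofactor (φ z * P.inG (g z)))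

variable {P} {φ : M → D} {g : M → G}

theorem gaugeForm_eq_zero {z : M} (h : φ =ᶠ[𝓝 z] fun _ => 1) (u v : M) :
    P.gaugeForm φ g u v z = 0 := by
  rw [gaugeForm, dressingForm, pwForm_eq_zero_of_left h, pwForm_eq_zero_of_right, sub_zero]
  filter_upwards [h] with w hw
  rw [hw, one_mul, P.cofactor_inG, map_one]

theorem isIsotropicMap_hom [LieGroup 𝓘(ℝ, EF) ∞ F] {j : F →* D}
    (hj : ContMDiff 𝓘(ℝ, EF) 𝓘(ℝ, E) ∞ j)
    (h : ∀ x ∈ lieAlgebraOf E EF j, ∀ y ∈ lieAlgebraOf E EF j, P.form x y = 0) {f : M → F}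
    (hf : ∀ z, SmoothAt EF f z) : IsIsotropicMap P.formL fun z => j (f z) :=
  fun z z' u u' => h _ (rlogDeriv_hom_mem hj (hf z) u) _ (rlogDeriv_hom_mem hj (hf z') u')

variable [LieGroup 𝓘(ℝ, E) ∞ D] [LieGroup 𝓘(ℝ, EG) ∞ G] [LieGroup 𝓘(ℝ, EH) ∞ H]

theorem smoothAt_dress {z : M} (hφ : SmoothAt E φ z) (hg : SmoothAt EG g z) :
    SmoothAt EG (fun w => P.dress (φ w) (g w)) z :=
  P.contMDiff_factor.contMDiffAt.comp z (hφ.mul_smoothAt (hg.hom P.isLieSubgroup_inG.smooth))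

theorem smoothAt_cofactor {z : M} (hφ : SmoothAt E φ z) (hg : SmoothAt EG g z) :
    SmoothAt EH (fun w => P.cofactor (φ w * P.inG (g w))) z :=
  P.contMDiff_cofactor.contMDiffAt.comp z (hφ.mul_smoothAt (hg.hom P.isLieSubgroup_inG.smooth))

theorem rlogDeriv_sub_rlogDeriv_dress_mem {z : M} (hφ : SmoothAt E φ z) (hg : SmoothAt EG g z)
    (u : M) : rlogDeriv E (fun w => φ w * P.inG (g w)) z u -
      rlogDeriv E (fun w => P.inG (P.dress (φ w) (g w))) z u ∈ P.twist (P.dress (φ z) (g z)) := by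
  rw [← funext fun w => P.dress_mul_cofactor (φ w) (g w),
    rlogDeriv_mul ((smoothAt_dress hφ hg).hom P.isLieSubgroup_inG.smooth)
    ((smoothAt_cofactor hφ hg).hom P.isLieSubgroup_inH.smooth), add_sub_cancel_left]
  exact Submodule.mem_map_of_mem
    (rlogDeriv_hom_mem P.isLieSubgroup_inH.smooth (smoothAt_cofactor hφ hg) u)

theorem gaugeForm_comp {j : M' → M} {z : M'} (hφ : SmoothAt E φ (j z)) (hg : SmoothAt EG g (j z))
    (hj : DifferentiableAt ℝ j z) (u v : M') :
    P.gaugeForm (fun w => φ (j w)) (fun w => g (j w)) u v z =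
      P.gaugeForm φ g (fderiv ℝ j z u) (fderiv ℝ j z v) (j z) := by
  rw [gaugeForm, gaugeForm, dressingForm, dressingForm,
    ← pwForm_comp hφ (hg.hom P.isLieSubgroup_inG.smooth) hj,
    ← pwForm_comp ((smoothAt_dress hφ hg).hom P.isLieSubgroup_inG.smooth)
      ((smoothAt_cofactor hφ hg).hom P.isLieSubgroup_inH.smooth) hj]

theorem isIsotropicSquare (hφ : ∀ z, SmoothAt E φ z) (hg : ∀ z, SmoothAt EG g z)
    (iφ : IsIsotropicMap P.formL φ) :
    IsIsotropicSquare P.formL φ (fun z => P.inG (g z)) (fun z => P.inG (P.dress (φ z) (g z)))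
      fun z => P.inH (P.cofactor (φ z * P.inG (g z))) :=
  have hG := P.isLieSubgroup_inG.smooth
  have hH := P.isLieSubgroup_inH.smooth
  have hdress := fun z => smoothAt_dress (P := P) (hφ z) (hg z)
  have hcofactor := fun z => smoothAt_cofactor (P := P) (hφ z) (hg z)
  { smoothAt₁ := hφ
    smoothAt₂ := fun z => (hg z).hom hG
    smoothAt₃ := fun z => (hdress z).hom hG
    smoothAt₄ := fun z => (hcofactor z).hom hH
    isotropic₁ := iφ
    isotropic₂ := isIsotropicMap_hom hG P.isotropicG hg
    isotropic₃ := isIsotropicMap_hom hG P.isotropicG hdress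
    isotropic₄ := isIsotropicMap_hom hH P.isotropicH hcofactor
    mul_eq := fun _ => (P.dress_mul_cofactor _ _).symm }

end PerfectDouble

end Dressing

/-! ### Gauge invariance of a coset model -/

section Invariance

attribute [local instance] lieNormedAddCommGroup lieNormedSpace lieTop

variable {E EG EH EF : Type*}
  [NormedAddCommGroup E] [NormedSpace ℝ E] [NormedAddCommGroup EG] [NormedSpace ℝ EG]
  [NormedAddCommGroup EH] [NormedSpace ℝ EH] [NormedAddCommGroup EF] [NormedSpace ℝ EF]
  {D G H F : Type*}
  [TopologicalSpace D] [ChartedSpace E D] [Group D]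
  [TopologicalSpace G] [ChartedSpace EG G] [Group G]
  [TopologicalSpace H] [ChartedSpace EH H] [Group H]
  [TopologicalSpace F] [ChartedSpace EF F] [Group F]

theorem IsGaugeTransformation.isField {f : Worldsheet → F} {K : Set Worldsheet}
    (hf : IsGaugeTransformation EF K f) : IsField EF f := by
  obtain ⟨h, hh, -, hone, -⟩ := hf
  rw [← funext hone]
  exact hh.comp (contDiff_const.prodMk contDiff_id).contMDiff

namespace PerfectDouble

variable {P : PerfectDouble E EG EH D G H} {i : F →* D} {S : Submodule ℝ (Lie E D)}
  {adm : G → Prop} {ℓ : G → P.alg → P.alg → ℝ} {f : Worldsheet → F} {g : Worldsheet → G}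

variable [FiniteDimensional ℝ E] [LieGroup 𝓘(ℝ, E) ∞ D] [LieGroup 𝓘(ℝ, EG) ∞ G]
  [LieGroup 𝓘(ℝ, EH) ∞ H]

theorem isField_gauge (hi : ContMDiff 𝓘(ℝ, EF) 𝓘(ℝ, E) ∞ i) (hf : IsField EF f)
    (hg : IsField EG g) : IsField EG (P.gauge i f g) :=
  fun z => smoothAt_dress (SmoothAt.hom hi (hf z)) (hg z)

variable [LieGroup 𝓘(ℝ, EF) ∞ F]

theorem IsCosetSpace.component_gauge (hS : P.IsCosetSpace EF i S)
    (hi : ContMDiff 𝓘(ℝ, EF) 𝓘(ℝ, E) ∞ i) (hf : IsField EF f) (hg : IsField EG g)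
    {z u : Worldsheet} {e : Lie E D} (he : e ∈ S)
    (h : e - (P.current g z u : Lie E D) ∈ P.twist (g z)) :
    Ad E (i (f z)) e + rlogDeriv E (fun w => i (f w)) z u ∈ S ∧
      Ad E (i (f z)) e + rlogDeriv E (fun w => i (f w)) z u -
        (P.current (P.gauge i f g) z u : Lie E D) ∈ P.twist (P.gauge i f g z) := by
  have hφ : SmoothAt E (fun w => i (f w)) z := SmoothAt.hom hi (hf z)
  refine ⟨S.add_mem (hS.Ad_mem _ _ he) (hS.le (rlogDeriv_hom_mem hi (hf z) u)), ?_⟩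
  have hAd := Submodule.mem_map_of_mem (f := Ad E (i (f z))) h
  rw [P.map_Ad_twist, P.current_eq hg, map_sub] at hAd
  have hdress := rlogDeriv_sub_rlogDeriv_dress_mem (P := P) hφ (hg z) u
  rw [rlogDeriv_mul hφ (SmoothAt.hom P.isLieSubgroup_inG.smooth (hg z))] at hdress
  rw [P.current_eq (isField_gauge hi hf hg)]
  convert add_mem hAd hdress using 1
  · simp only [gauge]
  · abel

theorem IsModel.metric_gauge (hm : P.IsModel S adm ℓ) (hS : P.IsCosetSpace EF i S)
    (hi : ContMDiff 𝓘(ℝ, EF) 𝓘(ℝ, E) ∞ i) (hf : IsField EF f) (hg : IsField EG g)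
    {z : Worldsheet} (hz : adm (g z)) (hz' : adm (P.gauge i f g z)) (u : Worldsheet) :
    ℓ (P.gauge i f g z) (P.current (P.gauge i f g) z u) (P.current (P.gauge i f g) z u) =
      ℓ (g z) (P.current g z u) (P.current g z u) := by
  obtain ⟨e, he, hea⟩ :=
    exists_sub_mem_of_codisjoint ((hm.adm_iff _).1 hz).codisjoint (P.current g z u : Lie E D)
  obtain ⟨he', hea'⟩ := hS.component_gauge hi hf hg he hea
  rw [hm.density_eq _ hz _ _ e he hea, hm.density_eq _ hz' _ _ _ he' hea']
  have hφ := rlogDeriv_hom_mem hi (hf z) u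
  have horth := hS.orthogonal _ hφ
  have hnorm : P.form (Ad E (i (f z)) e + rlogDeriv E (fun w => i (f w)) z u)
      (Ad E (i (f z)) e + rlogDeriv E (fun w => i (f w)) z u) = P.form e e := by
    have hφe := horth _ (hS.Ad_mem (f z) e he)
    rw [map_add, map_add, LinearMap.add_apply, LinearMap.add_apply, P.form_invariant, hφe,
      P.form_symm (Ad E (i (f z)) e), hφe, horth _ (hS.le hφ), add_zero, add_zero, add_zero]
  linarith [P.two_mul_form_of_sub_mem_twist hea, P.two_mul_form_of_sub_mem_twist hea']

theorem IsModel.lagrangian_gauge (hm : P.IsModel S adm ℓ) (hS : P.IsCosetSpace EF i S)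
    (hi : ContMDiff 𝓘(ℝ, EF) 𝓘(ℝ, E) ∞ i) (hf : IsField EF f) (hg : IsField EG g)
    {z : Worldsheet} (hz : adm (g z)) (hz' : adm (P.gauge i f g z)) :
    P.lagrangian ℓ (P.gauge i f g) z - P.lagrangian ℓ g z =
      P.gaugeForm (fun w => i (f w)) g dirPlus dirMinus z / 2 := by
  have hφ : ∀ z, SmoothAt E (fun w => i (f w)) z := fun z => SmoothAt.hom hi (hf z)
  have hγ := SmoothAt.hom P.isLieSubgroup_inG.smooth (hg z)
  obtain ⟨e, he, hea⟩ :=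
    exists_sub_mem_of_codisjoint ((hm.adm_iff _).1 hz).codisjoint
      (P.current g z dirPlus : Lie E D)
  obtain ⟨he', hea'⟩ := hS.component_gauge hi hf hg he hea
  have iφ : IsIsotropicMap P.formL fun w => i (f w) :=
    isIsotropicMap_hom hi (fun v hv x hx => hS.orthogonal v hv x (hS.le hx)) hf
  rw [gaugeForm, (isIsotropicSquare hφ hg iφ).dressingForm_eq P.form_symm P.form_invariant]
  rw [lagrangian, lagrangian, hm.density_eq _ hz _ _ e he hea,
    hm.density_eq _ hz' _ _ _ he' hea']
  set φ := rlogDeriv E (fun w => i (f w)) z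
  set χ := rlogDeriv E (fun w => i (f w) * P.inG (g w)) z dirMinus with hχ
  have hAd : P.form χ (Ad E (i (f z)) e) = P.form (P.current g z dirMinus) e := by
    rw [hχ, rlogDeriv_mul (hφ z) hγ, map_add, LinearMap.add_apply, P.form_invariant,
      ← P.current_eq hg, hS.orthogonal _ (rlogDeriv_hom_mem hi (hf z) _) _ (hS.Ad_mem _ _ he),
      zero_add]
  have hchange := P.form_twist (rlogDeriv_sub_rlogDeriv_dress_mem (P := P) (hφ z) (hg z) dirMinus)
    hea'
  have hisotropic := P.isotropicG _ (P.current (P.gauge i f g) z dirMinus).2 _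
    (P.current (P.gauge i f g) z dirPlus).2
  rw [P.current_eq (isField_gauge hi hf hg) z dirPlus] at hisotropic hchange
  rw [P.current_eq (isField_gauge hi hf hg) z dirMinus] at hisotropic ⊢
  have hformL (x : Lie E D) : P.formL x χ = P.form χ x := P.form_symm _ _
  rw [hformL]
  simp only [← hχ, map_sub, map_add, LinearMap.sub_apply, gauge] at hchange hisotropic hAd ⊢
  linarith

theorem IsCosetSpace.setIntegral_gaugeForm_eq_zero (hS : P.IsCosetSpace EF i S)
    (hi : ContMDiff 𝓘(ℝ, EF) 𝓘(ℝ, E) ∞ i) {K : Set Worldsheet} (hK : IsCompact K)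
    (hf : IsGaugeTransformation EF K f) (hg : IsField EG g) (u v : Worldsheet) :
    ∫ z in K, P.gaugeForm (fun w => i (f w)) g u v z = 0 := by
  obtain ⟨h, hh, hzero, hone, hoff⟩ := hf
  let φ (x : ℝ × Worldsheet) : D := i (h x)
  let γ (x : ℝ × Worldsheet) : G := g x.2
  have hφ : ∀ x, SmoothAt E φ x := fun x => SmoothAt.hom hi (hh x)
  have hγ : ∀ x, SmoothAt EG γ x := fun x => SmoothAt.comp_contDiffAt (hg x.2) contDiffAt_snd
  have hsquare := isIsotropicSquare (P := P) hφ hγ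
    (isIsotropicMap_hom hi (fun v hv x hx => hS.orthogonal v hv x (hS.le hx)) hh)
  have hclosed := setIntegral_sub_eq_zero_of_closed (μ := volume) (Ω := P.gaugeForm φ γ)
    (fun u v => (hsquare.contDiff_dressingForm P.form_symm u v).of_le (by simp))
    (hsquare.cyclic_fderiv_dressingForm P.form_symm P.form_invariant) hK
    (fun u v t z hz => gaugeForm_eq_zero ?_ u v) u v
  · have hslice (t : ℝ) (z : Worldsheet) : P.gaugeForm φ γ (0, u) (0, v) (t, z) =
        P.gaugeForm (fun w => i (h (t, w))) g u v z := by
      have hj := hasFDerivAt_prodMk_right (𝕜 := ℝ) t z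
      have hcomp := gaugeForm_comp (P := P) (hφ (t, z)) (hγ (t, z)) hj.differentiableAt u v
      rw [hj.fderiv] at hcomp
      exact hcomp.symm
    simpa only [hslice, hone, hzero, map_one,
      gaugeForm_eq_zero (EventuallyEq.refl _ fun _ => (1 : D)), sub_zero] using hclosed
  · filter_upwards [continuous_snd.continuousAt.eventually
      (hK.isClosed.isOpen_compl.mem_nhds hz)] with x hx
    rw [show φ x = i (h (x.1, x.2)) from rfl, hoff x.1 x.2 hx, map_one]

theorem IsModel.gaugeInvariant (hm : P.IsModel S adm ℓ) (hS : P.IsCosetSpace EF i S)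
    (hi : ContMDiff 𝓘(ℝ, EF) 𝓘(ℝ, E) ∞ i) : P.GaugeInvariant (EF := EF) i adm ℓ := by
  have hadm (f : F) (g : G) : adm (P.dress (i f) g) ↔ adm g := by
    rw [hm.adm_iff, hm.adm_iff, hS.isCompl_twist_dress_iff]
  refine ⟨hadm, fun f g hf hg => isField_gauge hi hf hg, fun f g z => ?_,
    fun K f g hK hf hg hKg => ?_,
    fun f g z u hf hg hz => hm.metric_gauge hS hi hf hg hz ((hadm _ _).2 hz) u⟩
  · exact @Quotient.sound _ (@MulAction.orbitRel F G _ (P.dressingAction i)) _ _ ⟨f z, rfl⟩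
  have hKg' : ∀ z ∈ K, adm (P.gauge i f g z) := fun z hz => (hadm _ _).2 (hKg z hz)
  have hint {g : Worldsheet → G} (hg : IsField EG g) (hKg : ∀ z ∈ K, adm (g z)) :
      IntegrableOn (P.lagrangian ℓ g) K :=
    ((P.continuousOn_lagrangian hm hg).mono hKg).integrableOn_compact hK
  have hint' := hint (isField_gauge hi hf.isField hg) hKg'
  refine ⟨hint hg hKg, hint', congrArg (1 / 2 * ·) (sub_eq_zero.1 ?_)⟩
  calc (∫ z in K, P.lagrangian ℓ (P.gauge i f g) z) - ∫ z in K, P.lagrangian ℓ g z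
      = ∫ z in K, P.gaugeForm (fun w => i (f w)) g dirPlus dirMinus z / 2 := by
        rw [← integral_sub hint' (hint hg hKg)]
        exact setIntegral_congr_fun hK.measurableSet fun z hz =>
          hm.lagrangian_gauge hS hi hf.isField hg (hKg z hz) (hKg' z hz)
    _ = 0 := by
      rw [integral_div, hS.setIntegral_gaugeForm_eq_zero hi hK hf hg, zero_div]

end PerfectDouble

end Invariance

/-! ### Dressing cosets -/

section CosetSpaces

variable {E EG EH EF : Type*}
  [NormedAddCommGroup E] [NormedSpace ℝ E] [NormedAddCommGroup EG] [NormedSpace ℝ EG]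
  [NormedAddCommGroup EH] [NormedSpace ℝ EH] [NormedAddCommGroup EF] [NormedSpace ℝ EF]
  {D G H F : Type*}
  [TopologicalSpace D] [ChartedSpace E D] [Group D]
  [TopologicalSpace G] [ChartedSpace EG G] [Group G]
  [TopologicalSpace H] [ChartedSpace EH H] [Group H]
  [TopologicalSpace F] [ChartedSpace EF F] [Group F]

namespace PerfectDouble

variable (P : PerfectDouble E EG EH D G H)

theorem J_add_Jhat (x : Lie E D) : (P.J x : Lie E D) + P.Jhat x = x :=
  Submodule.projection_add_projection_eq_self P.isCompl x

theorem J_dualAlg_add_alg (x : P.dualAlg) (y : P.alg) : P.J ((x : Lie E D) + y) = y := by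
  rw [map_add, J, Submodule.projectionOnto_apply_right P.isCompl,
    Submodule.projectionOnto_apply_left P.isCompl, zero_add]

theorem Jhat_dualAlg_add_alg (x : P.dualAlg) (y : P.alg) : P.Jhat ((x : Lie E D) + y) = x := by
  rw [map_add, Jhat, Submodule.projectionOnto_apply_left P.isCompl.symm,
    Submodule.projectionOnto_apply_right P.isCompl.symm, add_zero]

variable {V W : Type*} [AddCommGroup V] [Module ℝ V] [AddCommGroup W] [Module ℝ W]
  (ψ : V →ₗ[ℝ] P.dualAlg) (R : V →ₗ[ℝ] P.alg) (K : Submodule ℝ P.alg)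

/-- The map `x ↦ ψ x + R x`. The graph of an operator from a subspace of `𝒢̂` to `𝒢` is its range
when `ψ` is the inclusion of that subspace. -/
def graphHom : V →ₗ[ℝ] Lie E D := P.dualAlg.subtype ∘ₗ ψ + P.alg.subtype ∘ₗ R

/-- The sum of the graph `{ψ x + R x}` and of a subspace `K` of `𝒢`: the common form of the
subspaces from which the dressing cosets are built. -/
def cosetSpace : Submodule ℝ (Lie E D) :=
  LinearMap.range (P.graphHom ψ R) ⊔ K.map P.alg.subtype

variable {P ψ R K}

theorem mem_range_graphHom {s : Lie E D} :
    s ∈ LinearMap.range (P.graphHom ψ R) ↔ ∃ x, ψ x = P.Jhat s ∧ R x = P.J s := by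
  constructor
  · rintro ⟨x, rfl⟩
    exact ⟨x, (P.Jhat_dualAlg_add_alg _ _).symm, (P.J_dualAlg_add_alg _ _).symm⟩
  · rintro ⟨x, hJhat, hJ⟩
    refine ⟨x, ?_⟩
    change (ψ x : Lie E D) + R x = s
    rw [hJhat, hJ, add_comm, P.J_add_Jhat]

theorem mem_cosetSpace {s : Lie E D} :
    s ∈ P.cosetSpace ψ R K ↔ ∃ x, ∃ k ∈ K, (ψ x : Lie E D) + (R x + k : P.alg) = s := by
  simp only [cosetSpace, graphHom, Submodule.mem_sup, LinearMap.mem_range, Submodule.mem_map,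
    exists_exists_eq_and, exists_exists_and_eq_and, LinearMap.add_apply, LinearMap.comp_apply,
    Submodule.subtype_apply, Submodule.coe_add, add_assoc]

theorem form_eq_zero_of_mem_cosetSpace {N : Submodule ℝ V}
    (hN : ∀ γ ∈ N, ∀ x, P.form (R γ) (ψ x) + P.form (ψ γ) (R x) = 0)
    (hK : ∀ k ∈ K, ∀ x, P.form k (ψ x) = 0) {v s : Lie E D}
    (hv : v ∈ K.map P.alg.subtype ⊔ N.map (P.graphHom ψ R)) (hs : s ∈ P.cosetSpace ψ R K) :
    P.form v s = 0 := by
  obtain ⟨_, ⟨l, hl, rfl⟩, _, ⟨γ, hγ, rfl⟩, rfl⟩ := Submodule.mem_sup.1 hv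
  obtain ⟨x, k, hk, rfl⟩ := mem_cosetSpace.1 hs
  have hG := P.isotropicG _ (l + R γ).2 _ (R x + k).2
  have hH := P.isotropicH _ (ψ γ).2 _ (ψ x).2
  have hl := hK l hl x
  have hk := P.form_symm k (ψ γ) ▸ hK k hk γ
  have hγ := hN γ hγ x
  change P.form (l + ((ψ γ : Lie E D) + R γ)) _ = 0
  simp only [Submodule.coe_add, map_add, LinearMap.add_apply] at hG ⊢
  linarith

theorem isCosetSpace_cosetSpace {i : F →* D} {N : Submodule ℝ V}
    (hF : lieAlgebraOf E EF i = K.map P.alg.subtype ⊔ N.map (P.graphHom ψ R))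
    (hAd : ∀ f, ∀ s ∈ P.cosetSpace ψ R K, Ad E (i f) s ∈ P.cosetSpace ψ R K)
    (hN : ∀ γ ∈ N, ∀ x, P.form (R γ) (ψ x) + P.form (ψ γ) (R x) = 0)
    (hK : ∀ k ∈ K, ∀ x, P.form k (ψ x) = 0) : P.IsCosetSpace EF i (P.cosetSpace ψ R K) where
  Ad_mem := hAd
  le := by
    rw [hF, sup_comm]
    exact sup_le_sup_right LinearMap.map_le_range _
  orthogonal _ hv _ hs := form_eq_zero_of_mem_cosetSpace hN hK (hF ▸ hv) hs

theorem IsCosetSpace.swap {i : F →* D} {S : Submodule ℝ (Lie E D)} (h : P.IsCosetSpace EF i S) :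
    P.swap.IsCosetSpace EF i S :=
  ⟨h.Ad_mem, h.le, h.orthogonal⟩

variable [LieGroup 𝓘(ℝ, E) ∞ D] [LieGroup 𝓘(ℝ, EG) ∞ G]

variable (P) in
theorem sub_poisson_mem_twist (g : G) (x : P.dualAlg) :
    (x : Lie E D) - P.poisson g x ∈ P.twist g := by
  have hAd := Ad_mem_lieAlgebraOf P.isLieSubgroup_inG.smooth g (P.J (Ad E (P.inG g)⁻¹ x)).2
  have hpoisson : (P.poisson g x : Lie E D) = Ad E (P.inG g) (P.J (Ad E (P.inG g)⁻¹ x)) :=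
    congrArg Subtype.val (Submodule.projectionOnto_apply_left P.isCompl ⟨_, hAd⟩)
  refine ⟨P.Jhat (Ad E (P.inG g)⁻¹ x), (P.Jhat _).2, ?_⟩
  rw [hpoisson, eq_sub_iff_add_eq, add_comm, ← map_add, P.J_add_Jhat, Ad_Ad_inv]

variable (P) in
theorem isCompl_alg_twist (g : G) : IsCompl P.alg (P.twist g) := by
  have h := (isCompl_map_Ad (P.inG g)).2 P.isCompl
  rwa [map_Ad_lieAlgebraOf P.isLieSubgroup_inG.smooth] at h

theorem dualAlg_add_alg_mem_twist {g : G} {x : P.dualAlg} {y : P.alg} :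
    (x : Lie E D) + y ∈ P.twist g ↔ y + P.poisson g x = 0 := by
  have hsplit : (x : Lie E D) + y = (x - P.poisson g x) + (y + P.poisson g x : P.alg) := by
    push_cast
    abel
  rw [hsplit, Submodule.add_mem_iff_right _ (P.sub_poisson_mem_twist g x)]
  refine ⟨fun h => Subtype.ext ?_, fun h => h ▸ zero_mem _⟩
  exact Submodule.disjoint_def.1 (P.isCompl_alg_twist g).disjoint _ (Subtype.property _) h

theorem isCompl_twist_iff {S : Submodule ℝ (Lie E D)} {g : G} : IsCompl S (P.twist g) ↔
    Disjoint S (P.twist g) ∧ ∀ a : P.alg, ∃ e ∈ S, e - (a : Lie E D) ∈ P.twist g := by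
  rw [isCompl_iff]
  refine and_congr_right fun _ => ⟨fun h a => exists_sub_mem_of_codisjoint h a, fun h => ?_⟩
  refine Submodule.codisjoint_iff_exists_add_eq.2 fun z => ?_
  obtain ⟨a, t, ha, ht, rfl⟩ :=
    Submodule.codisjoint_iff_exists_add_eq.1 (P.isCompl_alg_twist g).codisjoint z
  obtain ⟨e, he, hea⟩ := h ⟨a, ha⟩
  exact ⟨e, t - (e - a), he, sub_mem ht hea, by abel⟩

variable (q : P.alg →ₗ[ℝ] W)

variable (ψ R) in
/-- The map `x ↦ q (R x + Π^g (ψ x))`. Its inverse defines the density of the model that is built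
from the sum of the graph `{ψ x + R x}` and of the kernel of `q`. -/
def reducedBackground (g : G) : V →ₗ[ℝ] W := q ∘ₗ (R + P.poisson g ∘ₗ ψ)

variable {q}

theorem reducedBackground_eq_iff {g : G} {x : V} {a : P.alg} :
    reducedBackground ψ R q g x = q a ↔
      ∃ k ∈ LinearMap.ker q, (ψ x : Lie E D) + (R x + k : P.alg) - a ∈ P.twist g := by
  have htwist (k : P.alg) : (ψ x : Lie E D) + (R x + k : P.alg) - a ∈ P.twist g ↔
      k = a - (R x + P.poisson g (ψ x)) := by
    rw [add_sub_assoc, ← Submodule.coe_sub, dualAlg_add_alg_mem_twist, ← sub_eq_zero (a := k)]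
    abel_nf
  simp only [htwist, exists_eq_right, LinearMap.mem_ker, map_sub, sub_eq_zero]
  exact eq_comm

theorem isCompl_cosetSpace_twist_iff (hψ : Function.Injective ψ) {g : G} :
    IsCompl (P.cosetSpace ψ R (LinearMap.ker q)) (P.twist g) ↔
      Function.Injective (reducedBackground ψ R q g) ∧
        LinearMap.range (reducedBackground ψ R q g) = LinearMap.range q := by
  have hle : LinearMap.range (reducedBackground ψ R q g) ≤ LinearMap.range q :=
    LinearMap.range_comp_le_range _ _
  rw [isCompl_twist_iff, Submodule.disjoint_def, injective_iff_map_eq_zero,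
    le_antisymm_iff, and_iff_right hle]
  refine and_congr ⟨fun h x hx => ?_, fun h s hs hst => ?_⟩ ⟨fun h => ?_, fun h a => ?_⟩
  · rw [← map_zero q, reducedBackground_eq_iff] at hx
    obtain ⟨k, hk, hxk⟩ := hx
    have hzero := h _ (mem_cosetSpace.2 ⟨x, k, hk, rfl⟩) (by simpa using hxk)
    refine hψ ?_
    rw [← P.Jhat_dualAlg_add_alg (ψ x), hzero, map_zero, map_zero]
  · obtain ⟨x, k, hk, rfl⟩ := mem_cosetSpace.1 hs
    obtain rfl := h x (by
      rw [← map_zero q, reducedBackground_eq_iff]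
      exact ⟨k, hk, by simpa using hst⟩)
    rw [dualAlg_add_alg_mem_twist, map_zero, map_zero, map_zero, add_zero] at hst
    rw [map_zero R, hst, map_zero, Submodule.coe_zero, Submodule.coe_zero, add_zero]
  · rintro _ ⟨a, rfl⟩
    obtain ⟨e, he, hea⟩ := h a
    obtain ⟨x, k, hk, rfl⟩ := mem_cosetSpace.1 he
    exact ⟨x, reducedBackground_eq_iff.2 ⟨k, hk, hea⟩⟩
  · obtain ⟨x, hx⟩ := h ⟨a, rfl⟩
    obtain ⟨k, hk, hxk⟩ := reducedBackground_eq_iff.1 hx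
    exact ⟨_, mem_cosetSpace.2 ⟨x, k, hk, rfl⟩, hxk⟩

theorem isModel_cosetSpace (hψ : Function.Injective ψ) {adm : G → Prop}
    {ℓ : G → P.alg → P.alg → ℝ}
    (hadm : ∀ g, adm g ↔ Function.Injective (reducedBackground ψ R q g) ∧
      LinearMap.range (reducedBackground ψ R q g) = LinearMap.range q)
    (hℓ : ∀ g, adm g → ∀ (b a : P.alg) (x : V), reducedBackground ψ R q g x = q a →
      ℓ g b a = P.form b (ψ x)) :
    P.IsModel (P.cosetSpace ψ R (LinearMap.ker q)) adm ℓ where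
  adm_iff g := (hadm g).trans (isCompl_cosetSpace_twist_iff hψ).symm
  density_eq g hg b a e he hea := by
    obtain ⟨x, k, hk, rfl⟩ := mem_cosetSpace.1 he
    rw [hℓ g hg b a x (reducedBackground_eq_iff.2 ⟨k, hk, hea⟩), map_add,
      P.isotropicG b b.2 _ (R x + k).2, add_zero]

end PerfectDouble

end CosetSpaces

section Operators

variable {E EG EH EF : Type*}
  [NormedAddCommGroup E] [NormedSpace ℝ E] [NormedAddCommGroup EG] [NormedSpace ℝ EG]
  [NormedAddCommGroup EH] [NormedSpace ℝ EH] [NormedAddCommGroup EF] [NormedSpace ℝ EF]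
  {D G H F : Type*}
  [TopologicalSpace D] [ChartedSpace E D] [Group D]
  [TopologicalSpace G] [ChartedSpace EG G] [Group G]
  [TopologicalSpace H] [ChartedSpace EH H] [Group H] [Group F]

theorem mem_kerP {V W : Type*} [AddCommGroup V] [Module ℝ V] [AddCommGroup W] [Module ℝ W]
    {R : V →ₗ.[ℝ] W} {x : V} : x ∈ kerP R ↔ ∃ h : x ∈ R.domain, R ⟨x, h⟩ = 0 := by
  simp only [kerP, Submodule.mem_map, LinearMap.mem_ker, Subtype.exists, Submodule.subtype_apply,
    exists_and_right, exists_eq_right]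
  rfl

namespace PerfectDouble

variable {P : PerfectDouble E EG EH D G H} {i : F →* D}

theorem swap_cosetSpace_symm (R : P.dualAlg ≃ₗ[ℝ] P.alg) :
    P.swap.cosetSpace LinearMap.id R.symm.toLinearMap ⊥ =
      P.cosetSpace LinearMap.id R.toLinearMap ⊥ := by
  simp only [cosetSpace, Submodule.map_bot, sup_bot_eq]
  ext s
  rw [mem_range_graphHom, mem_range_graphHom]
  simp only [LinearMap.id_apply, exists_eq_left, LinearEquiv.coe_coe]
  exact R.symm_apply_eq.trans eq_comm

theorem isModel_density [LieGroup 𝓘(ℝ, E) ∞ D] [LieGroup 𝓘(ℝ, EG) ∞ G]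
    (R : P.dualAlg ≃ₗ[ℝ] P.alg) :
    P.IsModel (P.cosetSpace LinearMap.id R.toLinearMap ⊥)
      (fun g => Function.Bijective (P.background R g)) (P.density R) := by
  have hR (g : G) : reducedBackground LinearMap.id R.toLinearMap LinearMap.id g =
    P.background R g := rfl
  rw [← LinearMap.ker_id]
  refine isModel_cosetSpace Function.injective_id (fun g => ?_) fun g hg b a x hx => ?_
  · rw [hR, LinearMap.range_id, LinearMap.range_eq_top]
    rfl
  · rw [density, ← show P.background R g x = a from hx, Function.leftInverse_invFun hg.1 x]
    rfl

namespace OperatorPair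

/-- The pair `R̂, R` on the double with the roles of `G` and `Ĝ` exchanged. -/
@[reducible] def swap (X : P.OperatorPair) : P.swap.OperatorPair where
  R := X.Rhat
  Rs := X.Rhats
  Rhat := X.R
  Rhats := X.Rs
  isAdjoint := X.isAdjoint_hat
  isAdjoint_hat := X.isAdjoint
  ker_eq := X.ker_hat_eq
  ker_hat_eq := X.ker_eq
  im_hat_le := X.im_le
  im_le := X.im_hat_le
  left_inv := X.right_inv
  right_inv := X.left_inv
  ann_ker_hat := X.ann_ker
  ann_ker := X.ann_ker_hat
  nondegenerate := by
    rw [sup_comm]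
    exact X.nondegenerate

/-- The subspace `{x + R x : x ∈ Dom R} + Ker R̂` of the generalized dressing cosets. It does not
change when the roles of `R` and `R̂` are exchanged, hence the duality of the models. -/
def cosetSpace (X : P.OperatorPair) : Submodule ℝ (Lie E D) :=
  P.cosetSpace X.R.domain.subtype X.R.toFun (kerP X.Rhat)

variable (X : P.OperatorPair)

theorem ker_hat_le_range_graphHom :
    (kerP X.Rhat).map P.alg.subtype ≤
      LinearMap.range (P.swap.graphHom X.Rhat.domain.subtype X.Rhat.toFun) := by
  rintro _ ⟨k, hk, rfl⟩
  obtain ⟨hkd, hk0⟩ := mem_kerP.1 hk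
  refine ⟨⟨k, hkd⟩, ?_⟩
  change (k : Lie E D) + (X.Rhat ⟨k, hkd⟩ : P.dualAlg) = k
  rw [hk0, Submodule.coe_zero, add_zero]

theorem sub_mem_ker_hat (y : X.Rhat.domain) :
    (y - X.R ⟨X.Rhat y, X.im_hat_le (mem_imP _ y)⟩ : P.alg) ∈ kerP X.Rhat := by
  have him := X.im_le (mem_imP X.R ⟨X.Rhat y, X.im_hat_le (mem_imP _ y)⟩)
  refine mem_kerP.2 ⟨sub_mem y.2 him, ?_⟩
  change X.Rhat (y - ⟨_, him⟩) = 0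
  rw [X.Rhat.map_sub, X.left_inv _ (mem_imP _ y), sub_self]

theorem swap_cosetSpace_le : X.swap.cosetSpace ≤ X.cosetSpace := by
  refine sup_le ?_ (X.swap.ker_hat_le_range_graphHom.trans le_sup_left)
  rintro _ ⟨y, rfl⟩
  refine mem_cosetSpace.2 ⟨⟨X.Rhat y, X.im_hat_le (mem_imP _ y)⟩, _, X.sub_mem_ker_hat y, ?_⟩
  change (X.Rhat y : Lie E D) + (X.R _ + ((y : P.alg) - X.R _) : P.alg) = (y : P.alg) + X.Rhat y
  rw [add_sub_cancel, add_comm]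

theorem swap_cosetSpace : X.swap.cosetSpace = X.cosetSpace :=
  le_antisymm X.swap_cosetSpace_le X.swap.swap_cosetSpace_le

variable {X}

theorem form_eq_zero_of_mem_ker_hat {k : P.alg} (hk : k ∈ kerP X.Rhat) (x : X.R.domain) :
    P.form k (x : P.dualAlg) = 0 := by
  have hx : (x : P.dualAlg) ∈ P.ann (kerP X.Rhat) := X.ann_ker_hat.ge x.2
  exact (P.form_symm _ _).trans (hx k hk)

theorem form_add_form_eq_zero_of_mem_ker {γ : X.R.domain} (hγ : (γ : P.dualAlg) ∈ kerP (X.R + X.Rs))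
    (x : X.R.domain) :
    P.form (X.R γ) (x : P.dualAlg) + P.form (γ : P.dualAlg) (X.R x) = 0 := by
  obtain ⟨hγd, hγ0⟩ := mem_kerP.1 hγ
  have hsum : X.R γ + X.Rs ⟨γ, hγd.2⟩ = 0 := hγ0
  have hadj := X.isAdjoint.adjoint x ⟨γ, hγd.2⟩
  rw [P.form_symm, P.form_symm _ (X.R x : Lie E D), hadj, ← map_add, ← Submodule.coe_add, hsum,
    Submodule.coe_zero, map_zero]

end OperatorPair

theorem PartialCondition.Ad_mem {R : P.dualAlg →ₗ.[ℝ] P.alg} (h : P.PartialCondition i R) (f : F)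
    {s : Lie E D} (hs : s ∈ LinearMap.range (P.graphHom R.domain.subtype R.toFun)) :
    Ad E (i f) s ∈ LinearMap.range (P.graphHom R.domain.subtype R.toFun) := by
  obtain ⟨x, rfl⟩ := hs
  obtain ⟨hdom, hR⟩ := h f x
  rw [← map_add, ← map_add] at hR
  refine mem_range_graphHom.2 ⟨⟨_, hdom⟩, ?_, hR.symm⟩
  exact (congrArg P.Jhat (map_add (Ad E (i f)) _ _)).trans (map_add _ _ _) |>.symm

theorem IsRho.apply_eq {R : P.dualAlg →ₗ.[ℝ] P.alg} {Rhat : P.alg →ₗ.[ℝ] P.dualAlg}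
    {ρ : P.alg →ₗ[ℝ] P.alg} (hρ : P.IsRho R Rhat ρ) {y : P.alg} (hy : y ∈ imP R) : ρ y = y := by
  obtain ⟨hidem, -, A, -, hrange⟩ := hρ
  exact (LinearMap.IsIdempotentElem.mem_range_iff hidem).1 (hrange ▸ Submodule.mem_sup_left hy)

theorem OperatorPair.isModel_genDensity [LieGroup 𝓘(ℝ, E) ∞ D] [LieGroup 𝓘(ℝ, EG) ∞ G]
    {X : P.OperatorPair} {ρ : P.alg →ₗ[ℝ] P.alg} (hρ : P.IsRho X.R X.Rhat ρ) :
    P.IsModel X.cosetSpace (P.GenAdmissible X.R ρ) (P.genDensity X.R ρ) := by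
  have hB (g : G) : reducedBackground X.R.domain.subtype X.R.toFun ρ g =
      P.genBackground X.R ρ g := by
    refine LinearMap.ext fun x => (map_add ρ _ _).trans ?_
    exact congrArg (· + _) (hρ.apply_eq (mem_imP X.R x))
  rw [OperatorPair.cosetSpace, ← hρ.2.1]
  refine isModel_cosetSpace X.R.domain.subtype_injective (fun g => ?_) fun g hg b a x hx => ?_
  · rw [hB]
    rfl
  · have hker : b - ρ b ∈ kerP X.Rhat := by
      rw [← hρ.2.1, LinearMap.mem_ker, map_sub, sub_eq_zero]
      exact (LinearMap.congr_fun hρ.1 b).symm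
    have hform := form_eq_zero_of_mem_ker_hat hker x
    rw [Submodule.coe_sub, map_sub, LinearMap.sub_apply, sub_eq_zero] at hform
    rw [hB] at hx
    rw [genDensity, ← hx, Function.leftInverse_invFun hg.1 x]
    exact hform.symm

variable [TopologicalSpace F] [ChartedSpace EF F]

theorem Condition.isCosetSpace {R Rs : P.dualAlg →ₗ[ℝ] P.alg}
    (hRs : ∀ x y : P.dualAlg, P.form (R x) y = P.form x (Rs y))
    (hF : lieAlgebraOf E EF i = P.fSpace R Rs) (hc : P.Condition i R) :
    P.IsCosetSpace EF i (P.cosetSpace LinearMap.id R ⊥) := by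
  refine isCosetSpace_cosetSpace (N := LinearMap.ker (R + Rs)) ?_ (fun f s hs => ?_)
    (fun γ hγ x => ?_) (fun k hk x => ?_)
  · rw [hF, Submodule.map_bot, bot_sup_eq]
    rfl
  · rw [cosetSpace, Submodule.map_bot, sup_bot_eq] at hs ⊢
    obtain ⟨x, rfl⟩ := hs
    refine mem_range_graphHom.2 ⟨_, rfl, ?_⟩
    change R (P.Jhat (Ad E (i f) (x + R x))) = P.J (Ad E (i f) (x + R x))
    rw [map_add, map_add, map_add, map_add, ← hc f x]
    abel
  · have hsum : P.form x ((R + Rs) γ) = 0 := by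
      rw [hγ, Submodule.coe_zero, map_zero]
    rw [LinearMap.add_apply, Submodule.coe_add, map_add, ← hRs] at hsum
    rw [P.form_symm, P.form_symm _ (R x : Lie E D)]
    exact hsum
  · rw [(Submodule.mem_bot ℝ).1 hk, Submodule.coe_zero, map_zero, LinearMap.zero_apply]

theorem OperatorPair.isCosetSpace {X : P.OperatorPair} (hF : lieAlgebraOf E EF i = X.fSpace)
    (h : P.PartialCondition i X.R) (hhat : P.swap.PartialCondition i X.Rhat) :
    P.IsCosetSpace EF i X.cosetSpace := by
  refine isCosetSpace_cosetSpace hF (fun f s hs => ?_)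
    (fun γ hγ x => form_add_form_eq_zero_of_mem_ker hγ x)
    (fun k hk x => form_eq_zero_of_mem_ker_hat hk x)
  obtain ⟨s₁, hs₁, s₂, hs₂, rfl⟩ := Submodule.mem_sup.1 hs
  rw [map_add]
  refine Submodule.add_mem _ (Submodule.mem_sup_left (h.Ad_mem f hs₁)) (X.swap_cosetSpace_le ?_)
  exact Submodule.mem_sup_left (hhat.Ad_mem f (X.ker_hat_le_range_graphHom hs₂))

end PerfectDouble

end Operators

/-! ### The matrices of Sfetsos -/

theorem mem_span_range_inl_iff {α μ V : Type*} [AddCommGroup V] [Module ℝ V]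
    (b : Module.Basis (α ⊕ μ) ℝ V) {x : V} :
    x ∈ Submodule.span ℝ (Set.range fun a => b (Sum.inl a)) ↔ ∀ M, b.repr x (Sum.inr M) = 0 := by
  rw [Set.range_comp' b Sum.inl, b.mem_span_image]
  simp [Set.subset_def, Sum.forall]

theorem mem_span_range_inr_iff {α μ V : Type*} [AddCommGroup V] [Module ℝ V]
    (b : Module.Basis (α ⊕ μ) ℝ V) {x : V} :
    x ∈ Submodule.span ℝ (Set.range fun M => b (Sum.inr M)) ↔ ∀ a, b.repr x (Sum.inl a) = 0 := by
  rw [Set.range_comp' b Sum.inr, b.mem_span_image]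
  simp [Set.subset_def, Sum.forall]

section Matrices

variable {E EG EH : Type*}
  [NormedAddCommGroup E] [NormedSpace ℝ E] [NormedAddCommGroup EG] [NormedSpace ℝ EG]
  [NormedAddCommGroup EH] [NormedSpace ℝ EH]
  {D G H : Type*}
  [TopologicalSpace D] [ChartedSpace E D] [Group D]
  [TopologicalSpace G] [ChartedSpace EG G] [Group G]
  [TopologicalSpace H] [ChartedSpace EH H] [Group H]

namespace PerfectDouble

variable (P : PerfectDouble E EG EH D G H)

/-- The components `⟨a | T^j⟩` of an element `a` of `𝒢`. -/
def pairing {ν : Type*} (T : ν → P.dualAlg) : P.alg →ₗ[ℝ] ν → ℝ :=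
  LinearMap.pi fun j => P.form.flip (T j) ∘ₗ P.alg.subtype

variable {P}

section Dual

variable {ι : Type*} [DecidableEq ι] {t : Module.Basis ι ℝ P.alg}

theorem form_eq_repr {T : ι → P.dualAlg}
    (hdual : ∀ i j, P.form (t i) (T j) = if i = j then 1 else 0) (y : P.alg) (j : ι) :
    P.form y (T j) = t.repr y j := by
  suffices h : P.form.flip (T j) ∘ₗ P.alg.subtype = t.coord j from LinearMap.congr_fun h y
  exact t.ext fun i => by simp [hdual, Finsupp.single_apply]

theorem form_eq_repr_dual {T : Module.Basis ι ℝ P.dualAlg}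
    (hdual : ∀ i j, P.form (t i) (T j) = if i = j then 1 else 0) (x : P.dualAlg) (j : ι) :
    P.form x (t j) = T.repr x j :=
  form_eq_repr (P := P.swap) (T := t)
    (fun i j => (P.form_symm _ _).trans ((hdual j i).trans (if_congr eq_comm rfl rfl))) x j

end Dual

section Model

variable {V ν : Type*} [AddCommGroup V] [Module ℝ V] [Fintype ν]
  {ψ : V →ₗ[ℝ] P.dualAlg} {R : V →ₗ[ℝ] P.alg} {T : ν → P.dualAlg} {C : Matrix ν ν ℝ}
  (d : Module.Basis ν ℝ V)

theorem reducedBackground_pairing (hT : ∀ j, ψ (d j) = T j)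
    (hC : ∀ i j, P.form (R (d i)) (T j) = C i j) (g : G) (x : V) :
    reducedBackground ψ R (P.pairing T) g x =
      Matrix.vecMul (d.equivFun x) (C + P.poissonMatrix T g) := by
  classical
  suffices h : reducedBackground ψ R (P.pairing T) g =
      (C + P.poissonMatrix T g).vecMulLinear ∘ₗ d.equivFun.toLinearMap from LinearMap.congr_fun h x
  refine d.ext fun i => funext fun j => ?_
  simp [reducedBackground, pairing, poissonMatrix, hT, hC, Finsupp.single_eq_pi_single]

variable [LieGroup 𝓘(ℝ, E) ∞ D] [LieGroup 𝓘(ℝ, EG) ∞ G] [DecidableEq ν]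

theorem isModel_matrixDensity (hψ : Function.Injective ψ) (hT : ∀ j, ψ (d j) = T j)
    (hC : ∀ i j, P.form (R (d i)) (T j) = C i j) :
    P.IsModel (P.cosetSpace ψ R (LinearMap.ker (P.pairing T)))
      (fun g => IsUnit (C + P.poissonMatrix T g).det)
      (P.matrixDensity T fun g => C + P.poissonMatrix T g) := by
  have hB := reducedBackground_pairing d hT hC
  have hcoe (g : G) : ⇑(reducedBackground ψ R (P.pairing T) g) =
      (fun c => Matrix.vecMul c (C + P.poissonMatrix T g)) ∘ d.equivFun := funext (hB g)
  refine isModel_cosetSpace hψ (fun g => ?_) fun g hg b a x hx => ?_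
  · rw [← Matrix.isUnit_iff_isUnit_det, hcoe, EquivLike.injective_comp,
      Matrix.vecMul_injective_iff_isUnit, iff_self_and]
    intro hunit
    have htop : LinearMap.range (reducedBackground ψ R (P.pairing T) g) = ⊤ := by
      rw [LinearMap.range_eq_top, hcoe, EquivLike.surjective_comp]
      exact Matrix.vecMul_surjective_iff_isUnit.2 hunit
    exact le_antisymm (LinearMap.range_comp_le_range _ _) (htop ▸ le_top)
  · have hd : d.equivFun x = Matrix.vecMul (P.pairing T a) (C + P.poissonMatrix T g)⁻¹ := by
      rw [← hx, hB, Matrix.vecMul_vecMul, Matrix.mul_nonsing_inv _ hg, Matrix.vecMul_one]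
    have hform : P.form b (ψ x) = d.equivFun x ⬝ᵥ P.pairing T b := by
      conv_lhs => rw [← d.sum_equivFun x]
      simp only [map_sum, map_smul, hT, Submodule.coe_sum, Submodule.coe_smul, smul_eq_mul]
      rfl
    rw [hform, hd, ← Matrix.dotProduct_mulVec]
    simp [matrixDensity, pairing, dotProduct, Matrix.mulVec, Finset.mul_sum, mul_assoc]

end Model

namespace OperatorPair.IsSfetsos

variable {α μ : Type*} [Fintype μ] [DecidableEq α] [DecidableEq μ]
  {X : P.OperatorPair} {t : Module.Basis (α ⊕ μ) ℝ P.alg} {T : Module.Basis (α ⊕ μ) ℝ P.dualAlg}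
  {Rm : Matrix μ μ ℝ} (h : X.IsSfetsos t T Rm)
include h

theorem fSpace_eq : X.fSpace = (kerP X.Rhat).map P.alg.subtype := by
  rw [OperatorPair.fSpace, h.ker_add_eq_bot, Submodule.comap_bot, Submodule.ker_subtype,
    Submodule.map_bot, sup_bot_eq]

theorem domain_hat_eq : X.Rhat.domain = ⊤ := by
  rw [← X.ann_ker, h.ker_eq_bot, eq_top_iff]
  intro y _ k hk
  rw [(Submodule.mem_bot ℝ).1 hk, Submodule.coe_zero, map_zero]

theorem domain_eq : X.R.domain = Submodule.span ℝ (Set.range fun M => T (Sum.inr M)) := by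
  refine le_antisymm (fun x hx => ?_) (h.im_hat_eq_span ▸ X.im_hat_le)
  rw [← X.ann_ker_hat, h.ker_hat_eq_span] at hx
  refine (mem_span_range_inr_iff T).2 fun a => ?_
  rw [← form_eq_repr_dual h.dual]
  exact hx _ (Submodule.subset_span ⟨a, rfl⟩)

/-- The basis `T^M` of `Dom R`. -/
def domainBasis : Module.Basis μ ℝ X.R.domain :=
  (Module.Basis.span (T.linearIndependent.comp _ Sum.inr_injective)).map
    (LinearEquiv.ofEq _ _ h.domain_eq.symm)

theorem coe_domainBasis (M : μ) : (h.domainBasis M : P.dualAlg) = T (Sum.inr M) := by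
  simp [domainBasis, Module.Basis.span_apply]

/-- The basis `t_i` of `Dom R̂`. -/
def domainHatBasis : Module.Basis (α ⊕ μ) ℝ X.Rhat.domain :=
  t.map (LinearEquiv.ofTop _ h.domain_hat_eq).symm

theorem coe_domainHatBasis (j : α ⊕ μ) : (h.domainHatBasis j : P.alg) = t j := by
  simp [domainHatBasis]

theorem map_domainBasis (M : μ) : X.R (h.domainBasis M) = ∑ N, Rm M N • t (Sum.inr N) := by
  obtain ⟨hM, hRM⟩ := h.matrix M
  rw [← hRM]
  exact congrArg X.R (Subtype.ext (h.coe_domainBasis M))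

theorem form_map_domainBasis (M N : μ) :
    P.form (X.R (h.domainBasis M)) (T (Sum.inr N)) = Rm M N := by
  simp [h.map_domainBasis, h.dual]

theorem sum_smul_map_domainHatBasis (M : μ) :
    ∑ N, Rm M N • X.Rhat (h.domainHatBasis (Sum.inr N)) = T (Sum.inr M) := by
  have hT : T (Sum.inr M) ∈ imP X.Rhat := by
    rw [h.im_hat_eq_span]
    exact Submodule.subset_span ⟨M, rfl⟩
  rw [← X.left_inv _ hT]
  simp only [← LinearPMap.toFun_eq_coe, ← map_smul, ← map_sum]
  refine congrArg X.Rhat.toFun (Subtype.ext ?_)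
  obtain ⟨_, hRM⟩ := h.matrix M
  simpa [h.coe_domainHatBasis] using hRM.symm

theorem map_domainHatBasis_inl (a : α) : X.Rhat (h.domainHatBasis (Sum.inl a)) = 0 := by
  have hker : t (Sum.inl a) ∈ kerP X.Rhat := by
    rw [h.ker_hat_eq_span]
    exact Submodule.subset_span ⟨a, rfl⟩
  obtain ⟨hdom, hzero⟩ := mem_kerP.1 hker
  rw [← hzero]
  exact congrArg X.Rhat (Subtype.ext (h.coe_domainHatBasis _))

theorem form_map_domainHatBasis_inr (M N : μ) :
    P.form (X.Rhat (h.domainHatBasis (Sum.inr M))) (t (Sum.inr N)) = Rm⁻¹ M N := by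
  suffices hinv : Rm * Matrix.of (fun M N =>
      P.form (X.Rhat (h.domainHatBasis (Sum.inr M))) (t (Sum.inr N))) = 1 by
    rw [Matrix.inv_eq_right_inv hinv, Matrix.of_apply]
  ext M K
  have hform := congrArg (fun x : P.dualAlg => P.form x (t (Sum.inr K)))
    (h.sum_smul_map_domainHatBasis M)
  simpa [Matrix.mul_apply, Matrix.one_apply, form_eq_repr_dual h.dual, Finsupp.single_apply]
    using hform

theorem form_map_domainHatBasis (j k : α ⊕ μ) :
    P.form (X.Rhat (h.domainHatBasis j)) (t k) = Matrix.fromBlocks 0 0 0 Rm⁻¹ j k := by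
  rcases j with a | M
  · rw [h.map_domainHatBasis_inl]
    rcases k with b | N <;> simp
  · rcases k with b | N
    · have him := mem_imP X.Rhat (h.domainHatBasis (Sum.inr M))
      rw [h.im_hat_eq_span, mem_span_range_inr_iff] at him
      rw [form_eq_repr_dual h.dual, him, Matrix.fromBlocks_apply₂₁, Matrix.zero_apply]
    · rw [h.form_map_domainHatBasis_inr, Matrix.fromBlocks_apply₂₂]

theorem ker_pairing : LinearMap.ker (P.pairing fun M => T (Sum.inr M)) = kerP X.Rhat := by
  ext y
  rw [h.ker_hat_eq_span, mem_span_range_inl_iff, LinearMap.mem_ker, funext_iff]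
  exact forall_congr' fun M => by rw [← form_eq_repr h.dual]; rfl

theorem ker_pairing_dual : LinearMap.ker (P.swap.pairing t) = kerP X.R := by
  rw [h.ker_eq_bot, LinearMap.ker_eq_bot']
  refine fun x hx => T.ext_elem_iff.2 fun j => ?_
  rw [map_zero, ← form_eq_repr_dual h.dual]
  exact congrFun hx j

variable [LieGroup 𝓘(ℝ, E) ∞ D]

theorem isModel [LieGroup 𝓘(ℝ, EG) ∞ G] :
    P.IsModel X.cosetSpace (fun g => IsUnit (P.sfetsosMatrix T Rm g).det)
      (P.matrixDensity (fun M => T (Sum.inr M)) (P.sfetsosMatrix T Rm)) := by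
  rw [OperatorPair.cosetSpace, ← h.ker_pairing]
  exact isModel_matrixDensity h.domainBasis X.R.domain.subtype_injective h.coe_domainBasis
    h.form_map_domainBasis

theorem isModel_dual [Fintype α] [LieGroup 𝓘(ℝ, EH) ∞ H] :
    P.swap.IsModel X.cosetSpace (fun g => IsUnit (P.sfetsosDualMatrix t Rm g).det)
      (P.swap.matrixDensity t (P.sfetsosDualMatrix t Rm)) := by
  have hmatrix : P.sfetsosDualMatrix t Rm =
      fun g => Matrix.fromBlocks 0 0 0 Rm⁻¹ + P.swap.poissonMatrix t g :=
    funext fun g => add_comm _ _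
  rw [← X.swap_cosetSpace, OperatorPair.cosetSpace, ← h.ker_pairing_dual, hmatrix]
  exact isModel_matrixDensity h.domainHatBasis X.Rhat.domain.subtype_injective
    h.coe_domainHatBasis h.form_map_domainHatBasis

end OperatorPair.IsSfetsos

end PerfectDouble

end Matrices

end

end DressingCosets

open DressingCosets in
theorem mainTheorem3_general
    {E EG EH EF : Type*}
    [NormedAddCommGroup E] [NormedSpace ℝ E] [FiniteDimensional ℝ E]
    [NormedAddCommGroup EG] [NormedSpace ℝ EG]
    [NormedAddCommGroup EH] [NormedSpace ℝ EH]
    [NormedAddCommGroup EF] [NormedSpace ℝ EF]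
    {D G H F : Type*}
    [TopologicalSpace D] [ChartedSpace E D] [Group D] [LieGroup 𝓘(ℝ, E) ∞ D]
    [TopologicalSpace G] [ChartedSpace EG G] [Group G] [LieGroup 𝓘(ℝ, EG) ∞ G]
    [TopologicalSpace H] [ChartedSpace EH H] [Group H] [LieGroup 𝓘(ℝ, EH) ∞ H]
    [TopologicalSpace F] [ChartedSpace EF F] [Group F] [LieGroup 𝓘(ℝ, EF) ∞ F]
    (P : PerfectDouble E EG EH D G H)
    (i : F →* D) (hi : ContMDiff 𝓘(ℝ, EF) 𝓘(ℝ, E) ∞ i) :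
    (∀ (R : P.dualAlg ≃ₗ[ℝ] P.alg) (Rs : P.dualAlg →ₗ[ℝ] P.alg),
      (∀ x y : P.dualAlg, P.form (R x) y = P.form x (Rs y)) →
      lieAlgebraOf E EF i = P.fSpace R Rs →
      P.Condition i R →
        P.GaugeInvariant (EF := EF) i
          (fun g => Function.Bijective (P.background R g)) (P.density R) ∧
        P.swap.GaugeInvariant (EF := EF) i
          (fun g => Function.Bijective (P.swap.background R.symm g)) (P.swap.density R.symm)) ∧
    (∀ X : P.OperatorPair,
      lieAlgebraOf E EF i = X.fSpace →
      P.PartialCondition i X.R →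
      P.swap.PartialCondition i X.Rhat →
        (∀ ρ : P.alg →ₗ[ℝ] P.alg, P.IsRho X.R X.Rhat ρ →
          P.GaugeInvariant (EF := EF) i (P.GenAdmissible X.R ρ) (P.genDensity X.R ρ)) ∧
        (∀ ρ : P.dualAlg →ₗ[ℝ] P.dualAlg, P.swap.IsRho X.Rhat X.R ρ →
          P.swap.GaugeInvariant (EF := EF) i
            (P.swap.GenAdmissible X.Rhat ρ) (P.swap.genDensity X.Rhat ρ))) ∧
    (∀ (α μ : Type*) [Fintype α] [Fintype μ] [DecidableEq α] [DecidableEq μ] (X : P.OperatorPair)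
      (t : Module.Basis (α ⊕ μ) ℝ P.alg) (T : Module.Basis (α ⊕ μ) ℝ P.dualAlg)
      (Rm : Matrix μ μ ℝ),
      X.IsSfetsos t T Rm →
      lieAlgebraOf E EF i = (kerP X.Rhat).map P.alg.subtype →
      P.PartialCondition i X.R →
      P.swap.PartialCondition i X.Rhat →
        P.GaugeInvariant (EF := EF) i
          (fun g => IsUnit (P.sfetsosMatrix T Rm g).det)
          (P.matrixDensity (fun M => T (Sum.inr M)) (P.sfetsosMatrix T Rm)) ∧
        P.swap.GaugeInvariant (EF := EF) i
          (fun g => IsUnit (P.sfetsosDualMatrix t Rm g).det)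
          (P.swap.matrixDensity t (P.sfetsosDualMatrix t Rm))) := by
  refine ⟨?_, ?_, ?_⟩
  · intro R Rs hRs hF hc
    have hS := hc.isCosetSpace hRs hF
    have hdual := PerfectDouble.isModel_density (P := P.swap) R.symm
    rw [PerfectDouble.swap_cosetSpace_symm] at hdual
    exact ⟨(PerfectDouble.isModel_density R).gaugeInvariant hS hi,
      hdual.gaugeInvariant hS.swap hi⟩
  · intro X hF hc hhat
    have hS := X.isCosetSpace hF hc hhat
    refine ⟨fun ρ hρ => (PerfectDouble.OperatorPair.isModel_genDensity hρ).gaugeInvariant hS hi,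
      fun ρ hρ => ?_⟩
    have hdual := PerfectDouble.OperatorPair.isModel_genDensity (X := X.swap) hρ
    rw [X.swap_cosetSpace] at hdual
    exact hdual.gaugeInvariant hS.swap hi
  · intro α μ _ _ _ _ X t T Rm h hF hc hhat
    have hS := X.isCosetSpace (hF.trans h.fSpace_eq.symm) hc hhat
    exact ⟨h.isModel.gaugeInvariant hS hi, h.isModel_dual.gaugeInvariant hS.swap hi⟩

open DressingCosets in
theorem mainTheorem3
    {E EG EH EF : Type*}
    [NormedAddCommGroup E] [NormedSpace ℝ E] [FiniteDimensional ℝ E]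
    [NormedAddCommGroup EG] [NormedSpace ℝ EG]
    [NormedAddCommGroup EH] [NormedSpace ℝ EH]
    [NormedAddCommGroup EF] [NormedSpace ℝ EF]
    {D G H F : Type*}
    [TopologicalSpace D] [ChartedSpace E D] [Group D] [LieGroup 𝓘(ℝ, E) ∞ D]
    [TopologicalSpace G] [ChartedSpace EG G] [Group G] [LieGroup 𝓘(ℝ, EG) ∞ G]
    [TopologicalSpace H] [ChartedSpace EH H] [Group H] [LieGroup 𝓘(ℝ, EH) ∞ H]
    [TopologicalSpace F] [ChartedSpace EF F] [Group F] [LieGroup 𝓘(ℝ, EF) ∞ F]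
    (P : PerfectDouble E EG EH D G H)
    (i : F →* D) (hi : IsLieSubgroup E EF i) :
    -- standard dressing cosets: the model on `G` and the dual model on `Ĝ`
    (∀ (R : P.dualAlg ≃ₗ[ℝ] P.alg) (Rs : P.dualAlg →ₗ[ℝ] P.alg),
      (∀ x y : P.dualAlg, P.form (R x) y = P.form x (Rs y)) →
      lieAlgebraOf E EF i = P.fSpace R Rs →
      P.Condition i R →
        P.GaugeInvariant (EF := EF) i
          (fun g => Function.Bijective (P.background R g)) (P.density R) ∧
        P.swap.GaugeInvariant (EF := EF) i
          (fun g => Function.Bijective (P.swap.background R.symm g)) (P.swap.density R.symm)) ∧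
    -- generalized dressing cosets: the model on `G` and the dual model on `Ĝ`
    (∀ X : P.OperatorPair,
      lieAlgebraOf E EF i = X.fSpace →
      P.PartialCondition i X.R →
      P.swap.PartialCondition i X.Rhat →
        (∀ ρ : P.alg →ₗ[ℝ] P.alg, P.IsRho X.R X.Rhat ρ →
          P.GaugeInvariant (EF := EF) i (P.GenAdmissible X.R ρ) (P.genDensity X.R ρ)) ∧
        (∀ ρ : P.dualAlg →ₗ[ℝ] P.dualAlg, P.swap.IsRho X.Rhat X.R ρ →
          P.swap.GaugeInvariant (EF := EF) i
            (P.swap.GenAdmissible X.Rhat ρ) (P.swap.genDensity X.Rhat ρ))) ∧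
    -- the model of Sfetsos on `G` and its dual on `Ĝ`
    (∀ (p q : ℕ) (X : P.OperatorPair)
      (t : Module.Basis (Fin p ⊕ Fin q) ℝ P.alg) (T : Module.Basis (Fin p ⊕ Fin q) ℝ P.dualAlg)
      (Rm : Matrix (Fin q) (Fin q) ℝ),
      X.IsSfetsos t T Rm →
      lieAlgebraOf E EF i = (kerP X.Rhat).map P.alg.subtype →
      P.PartialCondition i X.R →
      P.swap.PartialCondition i X.Rhat →
        P.GaugeInvariant (EF := EF) i
          (fun g => IsUnit (P.sfetsosMatrix T Rm g).det)
          (P.matrixDensity (fun M => T (Sum.inr M)) (P.sfetsosMatrix T Rm)) ∧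
        P.swap.GaugeInvariant (EF := EF) i
          (fun g => IsUnit (P.sfetsosDualMatrix t Rm g).det)
          (P.swap.matrixDensity t (P.sfetsosDualMatrix t Rm))) := by
  have h := mainTheorem3_general P i hi.smooth
  exact ⟨h.1, h.2.1, fun p q => h.2.2 (Fin p) (Fin q)⟩
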